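/- Let $R$ be an associative ring with unit and let $M$ be an $R$-bimodule. Put $M^{\otimes_R 0}=R$ and $M^{\otimes_R(i+1)}=M\otimes_R M^{\otimes_R i}$, and suppose that $M^{\otimes_R(N+1)}=0$ for some $N\geqslant 0$. Let $T=T_R(M)=\bigoplus_{i\geqslant 0}M^{\otimes_R i}$ be the tensor ring. Write $\mathrm{Ind}(Y)=T\otimes_R Y$ for a left $R$-module $Y$ and $\mathrm{Coind}(Y)=\mathrm{Hom}_{R^{op}}(T,Y)$ for a right $R$-module $Y$. Modules are left modules, and $R^{op}$-modules (resp. $T^{op}$-modules) are right $R$-modules (resp. right $T$-modules). A complete projective resolution over a ring $S$ is an exact complex $Q^\bullet$ (indexed by $\mathbb Z$) of projective $S$-modules such that $\mathrm{Hom}_S(Q^\bullet,P)$ is exact for every projective $S$-module $P$; an $S$-module is Gorenstein projective if it is isomorphic to $\ker(Q^0\to Q^1)$ for such a $Q^\bullet$. A complete injective resolution over $S$ is an exact complex $I^\bullet$ of injective $S$-modules such that $\mathrm{Hom}_S(E,I^\bullet)$ is exact for every injective $S$-module $E$; an $S$-module is Gorenstein injective if it is isomorphic to $\ker(I^0\to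 I^1)$ for such an $I^\bullet$. Suppose that $M$ satisfies condition (T): $\mathrm{Tor}^R_n(M,M^{\otimes_R i}\otimes_R P)=0$ for all $n\geqslant 1$, all $i\geqslant 1$ and all projective $R$-modules $P$. (1) If $\mathrm{pd}_R M<\infty$ and $\mathrm{fd}_{R^{op}}M<\infty$, then $M$ is - compatible: for every complete projective resolution $Q^\bullet$ of $T$-modules, the complex $M\otimes_R Q^\bullet$ is exact, and the complex $\mathrm{Hom}_T(Q^\bullet,\mathrm{Ind}(M\otimes_R P))$ is exact for every projective $R$-module $P$; and - admissible: $\mathrm{Ext}^1_R(G,M^{\otimes_R i}\otimes_R P)=0$ and $\mathrm{Tor}^R_1(M,M^{\otimes_R i}\otimes_R G)=0$ for every Gorenstein projective $R$-module $G$, every projective $R$-module $P$ and every $i\geqslant 0$. (2) If $\mathrm{fd}_R M<\infty$ and $\mathrm{pd}_{R^{op}}M<\infty$, then $M$ is - co-compatible: for every complete injective resolution $I^\bullet$ of $T^{op}$-modules, the complex $\mathrm{Hom}_{R^{op}}(M,I^\bullet)$ is exact, and the complex $\mathrm{Hom}_{T^{op}}(\mathrm{Coind}(\mathrm{Hom}_{R^{op}}(M,E)),I^\bullet)$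 is exact for every injective $R^{op}$-module $E$; and - co-admissible: $\mathrm{Ext}^1_{R^{op}}(\mathrm{Hom}_{R^{op}}(M^{\otimes_R i},E),H)=0$ and $\mathrm{Ext}^1_{R^{op}}(M,\mathrm{Hom}_{R^{op}}(M^{\otimes_R i},H))=0$ for every Gorenstein injective $R^{op}$-module $H$, every injective $R^{op}$-module $E$ and every $i\geqslant 0$. -/

import Mathlib

open CategoryTheory

universe u

namespace GorTensor

noncomputable section

open MulOpposite

/-! Right modules over a ring `R` are modules over `Rᵐᵒᵖ`: `op r • a` is `a · r`. -/

/-! ### Tensor products over a noncommutative ring -/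

section Tensor

/-- The subgroup of `A ⊗[ℤ] X` generated by the elements `(a · r) ⊗ x - a ⊗ (r · x)`. -/
def balancedRel (R A X : Type u) [Ring R] [AddCommGroup A] [Module Rᵐᵒᵖ A]
    [AddCommGroup X] [Module R X] : AddSubgroup (TensorProduct ℤ A X) :=
  AddSubgroup.closure
    {z | ∃ (a : A) (r : R) (x : X), z = (op r • a) ⊗ₜ[ℤ] x - a ⊗ₜ[ℤ] (r • x)}

/-- The tensor product `A ⊗_R X` of a right `R`-module `A` and a left `R`-module `X`. -/
def NTensor (R A X : Type u) [Ring R] [AddCommGroup A] [Module Rᵐᵒᵖ A]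
    [AddCommGroup X] [Module R X] : Type u :=
  TensorProduct ℤ A X ⧸ balancedRel R A X

namespace NTensor

variable {R A X : Type u} [Ring R] [AddCommGroup A] [Module Rᵐᵒᵖ A]
  [AddCommGroup X] [Module R X]

instance : AddCommGroup (NTensor R A X) :=
  inferInstanceAs (AddCommGroup (TensorProduct ℤ A X ⧸ balancedRel R A X))

variable (R) in
/-- The quotient map `A ⊗[ℤ] X → A ⊗_R X`. -/
def mk : TensorProduct ℤ A X →+ NTensor R A X := QuotientAddGroup.mk' (balancedRel R A X)

variable (R) in
/-- The pure tensor `a ⊗ x` in `A ⊗_R X`. -/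
def tmul (a : A) (x : X) : NTensor R A X := mk R (a ⊗ₜ[ℤ] x)

theorem tmul_add (a : A) (x y : X) : tmul R a (x + y) = tmul R a x + tmul R a y := by
  simp only [tmul, TensorProduct.tmul_add, map_add]

theorem add_tmul (a b : A) (x : X) : tmul R (a + b) x = tmul R a x + tmul R b x := by
  simp only [tmul, TensorProduct.add_tmul, map_add]

theorem zero_tmul (x : X) : tmul R (0 : A) x = 0 := by
  simpa using add_tmul (R := R) (0 : A) 0 x

theorem tmul_zero (a : A) : tmul R a (0 : X) = 0 := by
  simpa using tmul_add (R := R) a (0 : X) 0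

theorem smul_tmul (a : A) (r : R) (x : X) : tmul R (op r • a) x = tmul R a (r • x) := by
  rw [← sub_eq_zero]
  rw [tmul, tmul, ← map_sub]
  exact (QuotientAddGroup.eq_zero_iff _).2 (AddSubgroup.subset_closure ⟨a, r, x, rfl⟩)

theorem induction_on {p : NTensor R A X → Prop} (z : NTensor R A X) (h0 : p 0)
    (ht : ∀ a x, p (tmul R a x)) (ha : ∀ y z, p y → p z → p (y + z)) : p z := by
  obtain ⟨z, rfl⟩ : ∃ w, mk R w = z := QuotientAddGroup.mk'_surjective (balancedRel R A X) z
  induction z using TensorProduct.induction_on with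
  | zero => rw [map_zero]; exact h0
  | tmul a x => exact ht a x
  | add y z hy hz => rw [map_add]; exact ha _ _ hy hz

/-- The additive map out of `A ⊗_R X` given by a biadditive `R`-balanced map. -/
def lift {B : Type*} [AddCommGroup B] (f : A →+ X →+ B)
    (hf : ∀ (a : A) (r : R) (x : X), f (op r • a) x = f a (r • x)) : NTensor R A X →+ B :=
  QuotientAddGroup.lift (balancedRel R A X)
    (TensorProduct.liftAddHom f fun n a x => by simp)
    (by
      rw [balancedRel, AddSubgroup.closure_le]
      rintro _ ⟨a, r, x, rfl⟩
      simp [hf])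

@[simp] theorem lift_tmul {B : Type*} [AddCommGroup B] (f : A →+ X →+ B)
    (hf : ∀ (a : A) (r : R) (x : X), f (op r • a) x = f a (r • x)) (a : A) (x : X) :
    lift f hf (tmul R a x) = f a x := rfl

theorem addHom_ext {B : Type*} [AddCommGroup B] {f g : NTensor R A X →+ B}
    (h : ∀ a x, f (tmul R a x) = g (tmul R a x)) : f = g := by
  ext z
  induction z using induction_on with
  | h0 => simp
  | ht a x => exact h a x
  | ha y z hy hz => rw [map_add, map_add, hy, hz]

/-- `f ⊗ g` for a homomorphism `f` of right modules and a homomorphism `g` of left modules. -/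
def map {A' X' : Type u} [AddCommGroup A'] [Module Rᵐᵒᵖ A'] [AddCommGroup X'] [Module R X']
    (f : A →ₗ[Rᵐᵒᵖ] A') (g : X →ₗ[R] X') : NTensor R A X →+ NTensor R A' X' :=
  lift
    (AddMonoidHom.mk' (fun a => AddMonoidHom.mk' (fun x => tmul R (f a) (g x))
        fun x y => by rw [map_add, tmul_add])
      fun a b => by ext x; simp [add_tmul])
    fun a r x => by simp [smul_tmul]

@[simp] theorem map_tmul {A' X' : Type u} [AddCommGroup A'] [Module Rᵐᵒᵖ A'] [AddCommGroup X']
    [Module R X'] (f : A →ₗ[Rᵐᵒᵖ] A') (g : X →ₗ[R] X') (a : A) (x : X) :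
    map f g (tmul R a x) = tmul R (f a) (g x) := rfl

/-- If `A` is an `S`-`R`-bimodule, then `A ⊗_R X` is a left `S`-module, with
`s • (a ⊗ x) = (s • a) ⊗ x`. -/
instance {S : Type u} [Ring S] [Module S A] [SMulCommClass S Rᵐᵒᵖ A] :
    Module S (NTensor R A X) :=
  Module.compHom (NTensor R A X) <| show _ →+* AddMonoid.End (NTensor R A X) from
    { toFun := fun s => map
        ({ toFun := fun a => s • a
           map_add' := smul_add s
           map_smul' := fun r a => smul_comm s r a } : A →ₗ[Rᵐᵒᵖ] A) LinearMap.id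
      map_one' := addHom_ext fun a x => by
        simp only [map_tmul, LinearMap.coe_mk, AddHom.coe_mk, one_smul, LinearMap.id_coe, id_eq]
        rfl
      map_mul' := fun s t => addHom_ext fun a x => congrArg (tmul R · x) (mul_smul s t a)
      map_zero' := addHom_ext fun a x =>
        (congrArg (tmul R · x) (zero_smul S a)).trans
          (zero_tmul x)
      map_add' := fun s t => addHom_ext fun a x =>
        (congrArg (tmul R · x) (add_smul s t a)).trans (add_tmul _ _ x) }

@[simp] theorem smul_tmul' {S : Type u} [Ring S] [Module S A] [SMulCommClass S Rᵐᵒᵖ A]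
    (s : S) (a : A) (x : X) : s • tmul R a x = tmul R (s • a) x := rfl

/-- If `X` is an `R`-`S`-bimodule, then `A ⊗_R X` is a right `S`-module, with
`(a ⊗ x) · s = a ⊗ (x · s)`. -/
abbrev rightModule (S : Type u) [Ring S] [Module Sᵐᵒᵖ X] [SMulCommClass R Sᵐᵒᵖ X] :
    Module Sᵐᵒᵖ (NTensor R A X) :=
  Module.compHom (NTensor R A X) <| show _ →+* AddMonoid.End (NTensor R A X) from
    { toFun := fun s => map LinearMap.id
        ({ toFun := fun x => s • x
           map_add' := smul_add s
           map_smul' := fun r x => (smul_comm r s x).symm } : X →ₗ[R] X)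
      map_one' := addHom_ext fun a x => by
        simp only [map_tmul, LinearMap.coe_mk, AddHom.coe_mk, one_smul, LinearMap.id_coe, id_eq]
        rfl
      map_mul' := fun s t => addHom_ext fun a x => congrArg (tmul R a ·) (mul_smul s t x)
      map_zero' := addHom_ext fun a x =>
        (congrArg (tmul R a ·) (zero_smul Sᵐᵒᵖ x)).trans
          (tmul_zero a)
      map_add' := fun s t => addHom_ext fun a x =>
        (congrArg (tmul R a ·) (add_smul s t x)).trans (tmul_add a _ _) }

end NTensor

/-- An `R`-bimodule. -/
structure RBimod (R : Type u) [Ring R] where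
  carrier : Type u
  [addCommGroup : AddCommGroup carrier]
  [left : Module R carrier]
  [right : Module Rᵐᵒᵖ carrier]
  [comm : SMulCommClass R Rᵐᵒᵖ carrier]

attribute [instance] RBimod.addCommGroup RBimod.left RBimod.right RBimod.comm

variable (R M : Type u) [Ring R] [AddCommGroup M] [Module R M] [Module Rᵐᵒᵖ M]
  [SMulCommClass R Rᵐᵒᵖ M]

/-- The `R`-bimodule `M ⊗_R B`, for `R`-bimodules `M` and `B`. -/
def tensorBimod (B : RBimod R) : RBimod R :=
  letI : Module Rᵐᵒᵖ (NTensor R M B.carrier) := NTensor.rightModule R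
  { carrier := NTensor R M B.carrier
    comm := ⟨fun r s z => by
      induction z using NTensor.induction_on with
      | h0 => simp
      | ht a x => rfl
      | ha y z hy hz => simp only [smul_add, hy, hz]⟩ }

/-- The tensor powers `M^{⊗0} = R`, `M^{⊗(i+1)} = M ⊗_R M^{⊗i}` as `R`-bimodules. -/
def tensorPow : ℕ → RBimod R
  | 0 => { carrier := R }
  | i + 1 => tensorBimod R M (tensorPow i)

/-- The bimodule `M^{⊗i}`. -/
def TPow (i : ℕ) : Type u := (tensorPow R M i).carrier

instance (i : ℕ) : AddCommGroup (TPow R M i) := (tensorPow R M i).addCommGroup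
instance (i : ℕ) : Module R (TPow R M i) := (tensorPow R M i).left
instance (i : ℕ) : Module Rᵐᵒᵖ (TPow R M i) := (tensorPow R M i).right
instance (i : ℕ) : SMulCommClass R Rᵐᵒᵖ (TPow R M i) := (tensorPow R M i).comm

/-- `M` is `N`-nilpotent: `M^{⊗(N+1)} = 0`. -/
def IsNilpotentBimod (N : ℕ) : Prop := Subsingleton (TPow R M (N + 1))

end Tensor

/-! ### The tensor ring -/

section TensorRing

variable (R M : Type u) [Ring R] [AddCommGroup M] [Module R M] [Module Rᵐᵒᵖ M]
  [SMulCommClass R Rᵐᵒᵖ M]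

/-- The underlying group `⨁ i, M^{⊗i}` of the tensor ring `T_R(M)`. -/
def TensorRing : Type u := DirectSum ℕ (TPow R M)

namespace TensorRing

instance : AddCommGroup (TensorRing R M) := inferInstanceAs (AddCommGroup (DirectSum ℕ (TPow R M)))

/-- The componentwise left `R`-module structure on `⨁ i, M^{⊗i}`; an auxiliary definition, which
agrees with left multiplication by elements of `R` in the ring `T_R(M)`. -/
abbrev compModule : Module R (TensorRing R M) := inferInstanceAs (Module R (DirectSum ℕ (TPow R M)))

attribute [local instance] compModule

/-- The inclusion of `M^{⊗i}`. -/
def of (i : ℕ) : TPow R M i →+ TensorRing R M := DirectSum.of (TPow R M) i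

variable {R M}

theorem smul_of (r : R) (i : ℕ) (x : TPow R M i) : r • of R M i x = of R M i (r • x) :=
  (DirectSum.of_smul (M := TPow R M) R i r x).symm

/-- The additive map out of `⨁ i, M^{⊗i}` with given components. -/
def lift {B : Type*} [AddCommGroup B] (f : ∀ i, TPow R M i →+ B) : TensorRing R M →+ B :=
  DirectSum.toAddMonoid f

theorem lift_of {B : Type*} [AddCommGroup B] (f : ∀ i, TPow R M i →+ B) (i : ℕ)
    (x : TPow R M i) : lift f (of R M i x) = f i x :=
  DirectSum.toAddMonoid_of f i x

variable (R M) in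
/-- The identification `R = M^{⊗0}`. -/
def zeroEquiv : R ≃ₗ[R] TPow R M 0 := LinearEquiv.refl R R

theorem addHom_ext {B : Type*} [AddCommGroup B] {f g : TensorRing R M →+ B}
    (h : ∀ i x, f (of R M i x) = g (of R M i x)) : f = g :=
  DirectSum.addHom_ext h

/-- The element `m ⊗ x` of `M^{⊗(i+1)} = M ⊗_R M^{⊗i}`. -/
def cons (i : ℕ) (m : M) (x : TPow R M i) : TPow R M (i + 1) := NTensor.tmul R m x

theorem cons_induction {i : ℕ} {p : TPow R M (i + 1) → Prop} (z : TPow R M (i + 1)) (h0 : p 0)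
    (ht : ∀ m x, p (cons i m x)) (ha : ∀ y z, p y → p z → p (y + z)) : p z :=
  NTensor.induction_on (R := R) (A := M) (X := TPow R M i) (p := p) z h0 ht ha

theorem smul_cons (r : R) (i : ℕ) (m : M) (x : TPow R M i) :
    r • cons i m x = cons i (r • m) x := rfl

theorem cons_smul (r : R) (i : ℕ) (m : M) (x : TPow R M i) :
    cons i (op r • m) x = cons i m (r • x) := NTensor.smul_tmul m r x

variable (R M) in
/-- Left multiplication by `m ∈ M`, sending `x ∈ M^{⊗i}` to `m ⊗ x ∈ M^{⊗(i+1)}`. -/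
def shift : M →+ (TensorRing R M →+ TensorRing R M) :=
  AddMonoidHom.mk' (fun m => lift fun i =>
      (of R M (i + 1)).comp
        (AddMonoidHom.mk' (fun x => cons i m x) fun x y => NTensor.tmul_add m x y))
    fun m n => addHom_ext fun i x => by
      rw [AddMonoidHom.add_apply, lift_of, lift_of, lift_of]
      simp only [AddMonoidHom.comp_apply]
      rw [← map_add]
      exact congrArg _ (NTensor.add_tmul m n x)

theorem shift_of (m : M) (i : ℕ) (x : TPow R M i) :
    shift R M m (of R M i x) = of R M (i + 1) (cons i m x) :=
  lift_of _ i x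

theorem shift_smul_left (r : R) (m : M) (t : TensorRing R M) :
    shift R M (r • m) t = r • shift R M m t := by
  have : shift R M (r • m) = r • shift R M m := addHom_ext fun i x => by
    rw [AddMonoidHom.smul_apply, shift_of, shift_of, smul_of, smul_cons]
  rw [this, AddMonoidHom.smul_apply]

theorem shift_smul_right (r : R) (m : M) (t : TensorRing R M) :
    shift R M (op r • m) t = shift R M m (r • t) := by
  have : shift R M (op r • m) = (shift R M m).comp (DistribSMul.toAddMonoidHom _ r) :=
    addHom_ext fun i x => by
      simp only [AddMonoidHom.comp_apply, DistribSMul.toAddMonoidHom_apply]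
      rw [shift_of, smul_of, shift_of, cons_smul]
  rw [this]; rfl

/-- The biadditive map `(m, x) ↦ (t ↦ m · f(x)(t))`. -/
def actStep (i : ℕ) (f : TPow R M i →ₗ[R] (TensorRing R M →+ TensorRing R M)) :
    M →+ TPow R M i →+ (TensorRing R M →+ TensorRing R M) :=
  AddMonoidHom.mk' (fun m => AddMonoidHom.mk' (fun x => (shift R M m).comp (f x))
      fun x y => by ext t; simp)
    fun m n => by ext x t; simp

theorem actStep_balanced (i : ℕ) (f : TPow R M i →ₗ[R] (TensorRing R M →+ TensorRing R M))
    (m : M) (r : R) (x : TPow R M i) : actStep i f (op r • m) x = actStep i f m (r • x) := by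
  ext t
  change shift R M (op r • m) (f x t) = shift R M m (f (r • x) t)
  rw [shift_smul_right]
  exact congrArg _ (DFunLike.congr_fun (map_smul f r x) t).symm

variable (R M) in
/-- Left multiplication by elements of `M^{⊗i}`: an element `r ∈ R = M^{⊗0}` acts by the left
`R`-module structure, and `m ⊗ x ∈ M^{⊗(i+1)}` acts as `m` after `x`. -/
def actLin : (i : ℕ) → (TPow R M i →ₗ[R] (TensorRing R M →+ TensorRing R M))
  | 0 =>
    ({ toFun := fun r => DistribSMul.toAddMonoidHom _ r
       map_add' := fun r s => by ext t; exact add_smul r s t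
       map_smul' := fun r s => by ext t; exact mul_smul r s t } :
      R →ₗ[R] (TensorRing R M →+ TensorRing R M))
  | i + 1 =>
    ({ toFun := fun z => NTensor.lift (R := R) (A := M) (X := TPow R M i)
        (actStep i (actLin i)) (actStep_balanced i (actLin i)) z
       map_add' := fun y z => map_add _ y z
       map_smul' := fun r z => by
        induction z using NTensor.induction_on with
        | h0 => simp
        | ht m x =>
          ext t
          exact shift_smul_left r m (actLin i x t)
        | ha y z hy hz => rw [smul_add, map_add, map_add, hy, hz, smul_add] } :
      NTensor R M (TPow R M i) →ₗ[R] (TensorRing R M →+ TensorRing R M))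

variable (R M) in
/-- The unit `1 ∈ R = M^{⊗0}` of `T_R(M)`. -/
def unit : TensorRing R M := of R M 0 (zeroEquiv R M 1)

theorem actLin_zero (r : R) (t : TensorRing R M) :
    actLin R M 0 (zeroEquiv R M r) t = r • t := rfl

theorem actLin_cons (i : ℕ) (m : M) (x : TPow R M i) (t : TensorRing R M) :
    actLin R M (i + 1) (cons i m x) t = shift R M m (actLin R M i x t) := rfl

variable (R M) in
/-- The multiplication of `T_R(M)`: on homogeneous elements it is the concatenation
`M^{⊗i} ⊗_R M^{⊗j} ≅ M^{⊗(i+j)}`. -/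
def mulHom : TensorRing R M →+ (TensorRing R M →+ TensorRing R M) :=
  lift fun i => (actLin R M i).toAddMonoidHom

theorem mulHom_of (i : ℕ) (x : TPow R M i) (t : TensorRing R M) :
    mulHom R M (of R M i x) t = actLin R M i x t := by
  rw [mulHom, lift_of]; rfl

theorem mulHom_smul (r : R) (t s : TensorRing R M) :
    mulHom R M (r • t) s = r • mulHom R M t s := by
  have : (mulHom R M).comp (DistribSMul.toAddMonoidHom _ r) =
      (DistribSMul.toAddMonoidHom _ r : (TensorRing R M →+ TensorRing R M) →+ _).comp
        (mulHom R M) :=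
    addHom_ext fun i x => by
      ext t
      simp only [AddMonoidHom.comp_apply, DistribSMul.toAddMonoidHom_apply,
        AddMonoidHom.smul_apply]
      rw [smul_of, mulHom_of, mulHom_of, map_smul, AddMonoidHom.smul_apply]
  exact congrArg (fun f => f s) (DFunLike.congr_fun this t)

theorem mulHom_shift (m : M) (t s : TensorRing R M) :
    mulHom R M (shift R M m t) s = shift R M m (mulHom R M t s) := by
  have : (mulHom R M).comp (shift R M m) =
      (AddMonoidHom.compHom (shift R M m)).comp (mulHom R M) :=
    addHom_ext fun i x => by
      ext t
      simp only [AddMonoidHom.comp_apply, AddMonoidHom.compHom_apply_apply]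
      rw [shift_of, mulHom_of, mulHom_of, actLin_cons]
  exact congrArg (fun f => f s) (DFunLike.congr_fun this t)

theorem mulHom_actLin (i : ℕ) (x : TPow R M i) (t s : TensorRing R M) :
    mulHom R M (actLin R M i x t) s = actLin R M i x (mulHom R M t s) := by
  induction i with
  | zero =>
    obtain ⟨r, rfl⟩ := (zeroEquiv R M).surjective x
    rw [actLin_zero, actLin_zero, mulHom_smul]
  | succ i ih =>
    induction x using cons_induction with
    | h0 => simp
    | ht m x => rw [actLin_cons, actLin_cons, mulHom_shift, ih]
    | ha y z hy hz => simp only [map_add, AddMonoidHom.add_apply, hy, hz]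

theorem actLin_unit (i : ℕ) (x : TPow R M i) : actLin R M i x (unit R M) = of R M i x := by
  induction i with
  | zero =>
    obtain ⟨r, rfl⟩ := (zeroEquiv R M).surjective x
    rw [actLin_zero, unit, smul_of, ← map_smul, smul_eq_mul, mul_one]
  | succ i ih =>
    induction x using cons_induction with
    | h0 => simp
    | ht m x => rw [actLin_cons, ih, shift_of]
    | ha y z hy hz => simp only [map_add, AddMonoidHom.add_apply, hy, hz]

/-- The ring structure on the tensor ring `T_R(M) = ⨁ i, M^{⊗i}`. -/
instance : Ring (TensorRing R M) :=
  { (inferInstance : AddCommGroup (TensorRing R M)) with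
    mul := fun t s => mulHom R M t s
    one := unit R M
    left_distrib := fun t s s' => map_add (mulHom R M t) s s'
    right_distrib := fun t t' s => by
      change mulHom R M (t + t') s = mulHom R M t s + mulHom R M t' s
      rw [map_add, AddMonoidHom.add_apply]
    zero_mul := fun t => by
      change mulHom R M 0 t = 0
      rw [map_zero, AddMonoidHom.zero_apply]
    mul_zero := fun t => map_zero (mulHom R M t)
    mul_assoc := fun t s s' => by
      change mulHom R M (mulHom R M t s) s' = mulHom R M t (mulHom R M s s')
      have key : (((mulHom R M).flip s').comp ((mulHom R M).flip s)) =
          (mulHom R M).flip (mulHom R M s s') := addHom_ext fun i x => by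
        simp only [AddMonoidHom.comp_apply, AddMonoidHom.flip_apply]
        rw [mulHom_of, mulHom_of, mulHom_actLin]
      exact DFunLike.congr_fun key t
    one_mul := fun t => by
      change mulHom R M (of R M 0 (zeroEquiv R M 1)) t = t
      rw [mulHom_of, actLin_zero, one_smul]
    mul_one := fun t => by
      change mulHom R M t (unit R M) = t
      have key : (mulHom R M).flip (unit R M) = AddMonoidHom.id _ := addHom_ext fun i x => by
        rw [AddMonoidHom.flip_apply, mulHom_of, actLin_unit]; rfl
      exact DFunLike.congr_fun key t }

variable (R M) in
/-- The ring homomorphism `R → T_R(M)` onto the degree-zero component. -/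
def incl : R →+* TensorRing R M where
  toFun := fun r => of R M 0 (zeroEquiv R M r)
  map_one' := rfl
  map_mul' := fun r s => by
    change _ = mulHom R M (of R M 0 _) (of R M 0 _)
    rw [mulHom_of, actLin_zero, smul_of, ← map_smul, smul_eq_mul]
  map_zero' := by rw [map_zero, map_zero]
  map_add' := fun r s => by rw [map_add, map_add]

/-- `T_R(M)` as a right `R`-module, via `incl`. -/
instance : Module Rᵐᵒᵖ (TensorRing R M) := Module.compHom (TensorRing R M) (incl R M).op

instance : SMulCommClass (TensorRing R M) Rᵐᵒᵖ (TensorRing R M) :=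
  ⟨fun t r s => (mul_assoc t s (incl R M r.unop)).symm⟩

end TensorRing

end TensorRing

/-! ### Homological notions over a ring -/

section Homological

variable (R : Type u) [Ring R]

/-- The functor `A ⊗_R -` for a right `R`-module `A`. -/
def tensorFunctor (A : Type u) [AddCommGroup A] [Module Rᵐᵒᵖ A] :
    ModuleCat.{u} R ⥤ AddCommGrpCat.{u} where
  obj X := AddCommGrpCat.of (NTensor R A X)
  map f := AddCommGrpCat.ofHom (NTensor.map LinearMap.id f.hom)
  map_id X := by
    ext z
    exact DFunLike.congr_fun (NTensor.addHom_ext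
      (f := NTensor.map LinearMap.id (ModuleCat.Hom.hom (𝟙 X)))
      (g := AddMonoidHom.id _) fun a x => rfl) z
  map_comp f g := by
    ext z
    exact DFunLike.congr_fun (NTensor.addHom_ext
      (f := NTensor.map LinearMap.id (f ≫ g).hom)
      (g := (NTensor.map LinearMap.id g.hom).comp (NTensor.map LinearMap.id f.hom))
      fun a x => rfl) z

instance (A : Type u) [AddCommGroup A] [Module Rᵐᵒᵖ A] : (tensorFunctor R A).Additive where
  map_add {X Y f g} := by
    ext z
    exact DFunLike.congr_fun (NTensor.addHom_ext
      (f := NTensor.map LinearMap.id (f + g).hom)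
      (g := NTensor.map LinearMap.id f.hom + NTensor.map LinearMap.id g.hom)
      fun a x => by
        rw [AddMonoidHom.add_apply]
        exact NTensor.tmul_add (R := R) a (f.hom x) (g.hom x)) z

/-- `Tor_n^R(A, X) = 0`, where `Tor_n^R(A, -)` is the `n`-th left derived functor of `A ⊗_R -`. -/
def TorVanishes (A : Type u) [AddCommGroup A] [Module Rᵐᵒᵖ A] (n : ℕ) (X : ModuleCat.{u} R) :
    Prop :=
  Limits.IsZero (((tensorFunctor R A).leftDerived n).obj X)

variable {R}

/-- `Ext^n_R(X, Y) = 0`. -/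
def ExtVanishes (n : ℕ) (X Y : ModuleCat.{u} R) : Prop := Subsingleton (Abelian.Ext X Y n)

/-- A left `R`-module `F` is flat: `- ⊗_R F` preserves injectivity. -/
def IsFlatLeft (F : ModuleCat.{u} R) : Prop :=
  ∀ (A B : Type u) [AddCommGroup A] [AddCommGroup B] [Module Rᵐᵒᵖ A] [Module Rᵐᵒᵖ B]
    (f : A →ₗ[Rᵐᵒᵖ] B), Function.Injective f →
      Function.Injective (NTensor.map (R := R) f (LinearMap.id (M := F)))

/-- A right `R`-module `F` is flat: `F ⊗_R -` preserves injectivity. -/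
def IsFlatRight (F : ModuleCat.{u} Rᵐᵒᵖ) : Prop :=
  ∀ (X Y : Type u) [AddCommGroup X] [AddCommGroup Y] [Module R X] [Module R Y]
    (f : X →ₗ[R] Y), Function.Injective f →
      Function.Injective (NTensor.map (R := R) (LinearMap.id (M := F)) f)

/-- There is an exact sequence `0 → F_n → ⋯ → F_1 → F_0 → X → 0` whose terms `F_i` all satisfy
`C` (for a property `C` invariant under isomorphism). -/
def HasResolutionOfLength (C : ModuleCat.{u} R → Prop) : ℕ → ModuleCat.{u} R → Prop
  | 0, X => C X
  | n + 1, X => ∃ (F : ModuleCat.{u} R) (f : F ⟶ X), C F ∧ Function.Surjective f ∧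
      HasResolutionOfLength C n (ModuleCat.of R (LinearMap.ker f.hom))

/-- The left `R`-module `X` has finite flat dimension. -/
def FiniteFlatDimLeft (X : ModuleCat.{u} R) : Prop :=
  ∃ n, HasResolutionOfLength IsFlatLeft n X

/-- The right `R`-module `X` has finite flat dimension. -/
def FiniteFlatDimRight (X : ModuleCat.{u} Rᵐᵒᵖ) : Prop :=
  ∃ n, HasResolutionOfLength (IsFlatRight (R := R)) n X

/-- The complex of groups `Hom_R(Q, P)` is exact. -/
def HomIntoExact (Q : CochainComplex (ModuleCat.{u} R) ℤ) (P : ModuleCat.{u} R) : Prop :=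
  ∀ (j : ℤ) (f : Q.X j ⟶ P), Q.d (j - 1) j ≫ f = 0 →
    ∃ g : Q.X (j + 1) ⟶ P, Q.d j (j + 1) ≫ g = f

/-- The complex of groups `Hom_R(E, I)` is exact. -/
def HomFromExact (E : ModuleCat.{u} R) (I : CochainComplex (ModuleCat.{u} R) ℤ) : Prop :=
  ∀ (j : ℤ) (f : E ⟶ I.X j), f ≫ I.d j (j + 1) = 0 →
    ∃ g : E ⟶ I.X (j - 1), g ≫ I.d (j - 1) j = f

/-- Complete projective resolutions. -/
structure IsCompleteProjRes (Q : CochainComplex (ModuleCat.{u} R) ℤ) : Prop where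
  exact : Q.Acyclic
  projective : ∀ j, Projective (Q.X j)
  hom_exact : ∀ P : ModuleCat.{u} R, Projective P → HomIntoExact Q P

/-- Complete injective resolutions. -/
structure IsCompleteInjRes (I : CochainComplex (ModuleCat.{u} R) ℤ) : Prop where
  exact : I.Acyclic
  injective : ∀ j, Injective (I.X j)
  hom_exact : ∀ E : ModuleCat.{u} R, Injective E → HomFromExact E I

/-- Gorenstein projective modules. -/
def IsGorensteinProjective (G : ModuleCat.{u} R) : Prop :=
  ∃ Q : CochainComplex (ModuleCat.{u} R) ℤ, IsCompleteProjRes Q ∧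
    Nonempty (G ≅ Limits.kernel (Q.d 0 1))

/-- Gorenstein injective modules. -/
def IsGorensteinInjective (H : ModuleCat.{u} R) : Prop :=
  ∃ I : CochainComplex (ModuleCat.{u} R) ℤ, IsCompleteInjRes I ∧
    Nonempty (H ≅ Limits.kernel (I.d 0 1))

end Homological

/-! ### Compatible and admissible bimodules -/

section Bimodules

/-- The left `S`-module `A ⊗_R X`, for an `S`-`R`-bimodule `A` and a left `R`-module `X`. -/
abbrev tensorObj {R : Type u} (S A : Type u) [Ring R] [Ring S] [AddCommGroup A] [Module S A]
    [Module Rᵐᵒᵖ A] [SMulCommClass S Rᵐᵒᵖ A] (X : ModuleCat.{u} R) : ModuleCat.{u} S :=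
  ModuleCat.of S (NTensor R A X)

/-- The right `R`-module structure `(f · r)(a) = f(r a)` on `Hom_{Rᵒᵖ}(A, Y)`, for an
`R`-bimodule `A` and a right `R`-module `Y`. -/
abbrev homModule (R A Y : Type u) [Ring R] [AddCommGroup A] [Module R A] [Module Rᵐᵒᵖ A]
    [SMulCommClass R Rᵐᵒᵖ A] [AddCommGroup Y] [Module Rᵐᵒᵖ Y] : Module Rᵐᵒᵖ (A →ₗ[Rᵐᵒᵖ] Y) where
  smul r f :=
    { toFun := fun a => f (r.unop • a)
      map_add' := fun a b => by simp
      map_smul' := fun s a => by simp [smul_comm r.unop s a] }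
  one_smul f := by ext a; exact congrArg f (one_smul R a)
  mul_smul r s f := by ext a; exact congrArg f (mul_smul s.unop r.unop a)
  smul_zero r := rfl
  smul_add r f g := rfl
  add_smul r s f := by
    ext a
    exact (congrArg f (add_smul r.unop s.unop a)).trans (map_add f _ _)
  zero_smul f := by ext a; exact (congrArg f (zero_smul R a)).trans (map_zero f)

/-- The right `R`-module `Hom_{Rᵒᵖ}(A, Y)`. -/
def homObj {R : Type u} (A : Type u) [Ring R] [AddCommGroup A] [Module R A] [Module Rᵐᵒᵖ A]
    [SMulCommClass R Rᵐᵒᵖ A] (Y : ModuleCat.{u} Rᵐᵒᵖ) : ModuleCat.{u} Rᵐᵒᵖ :=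
  letI := homModule R A Y
  ModuleCat.of Rᵐᵒᵖ (A →ₗ[Rᵐᵒᵖ] Y)

variable (R M X : Type u) [Ring R]
  [AddCommGroup M] [Module R M] [Module Rᵐᵒᵖ M] [SMulCommClass R Rᵐᵒᵖ M]
  [AddCommGroup X] [Module R X] [Module Rᵐᵒᵖ X] [SMulCommClass R Rᵐᵒᵖ X]

/-- The induction functor on objects: `Ind(Y) = T_R(M) ⊗_R Y`, a left `T_R(M)`-module. -/
abbrev Ind (Y : ModuleCat.{u} R) : ModuleCat.{u} (TensorRing R M) :=
  tensorObj (TensorRing R M) (TensorRing R M) Y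

/-- The coinduction functor on objects: `Coind(Y) = Hom_{Rᵒᵖ}(T_R(M), Y)`, a right
`T_R(M)`-module. -/
abbrev Coind (Y : ModuleCat.{u} Rᵐᵒᵖ) : ModuleCat.{u} (TensorRing R M)ᵐᵒᵖ :=
  (ModuleCat.coextendScalars (TensorRing.incl R M).op).obj Y

/-- The complex of left `R`-modules underlying a complex of left `T_R(M)`-modules. -/
abbrev restrictComplex (Q : CochainComplex (ModuleCat.{u} (TensorRing R M)) ℤ) :
    CochainComplex (ModuleCat.{u} R) ℤ :=
  ((ModuleCat.restrictScalars (TensorRing.incl R M)).mapHomologicalComplex _).obj Q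

/-- The complex of right `R`-modules underlying a complex of right `T_R(M)`-modules. -/
abbrev restrictComplexOp (I : CochainComplex (ModuleCat.{u} (TensorRing R M)ᵐᵒᵖ) ℤ) :
    CochainComplex (ModuleCat.{u} Rᵐᵒᵖ) ℤ :=
  ((ModuleCat.restrictScalars (TensorRing.incl R M).op).mapHomologicalComplex _).obj I

/-- Condition (T): `Tor_n^R(X, X^{⊗i} ⊗_R P) = 0` for all `n, i ≥ 1` and all projective left
`R`-modules `P`. -/
def ConditionT : Prop :=
  ∀ P : ModuleCat.{u} R, Projective P → ∀ i : ℕ, 1 ≤ i → ∀ n : ℕ, 1 ≤ n →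
    TorVanishes R X n (tensorObj R (TPow R X i) P)

/-- `X` is compatible (with respect to the tensor ring `T_R(M)`). -/
def IsCompatible : Prop :=
  ∀ Q : CochainComplex (ModuleCat.{u} (TensorRing R M)) ℤ, IsCompleteProjRes Q →
    (((tensorFunctor R X).mapHomologicalComplex _).obj (restrictComplex R M Q)).Acyclic ∧
    ∀ P : ModuleCat.{u} R, Projective P → HomIntoExact Q (Ind R M (tensorObj R X P))

/-- `X` is admissible. -/
def IsAdmissible : Prop :=
  ∀ G : ModuleCat.{u} R, IsGorensteinProjective G → ∀ P : ModuleCat.{u} R, Projective P →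
    ∀ i : ℕ, ExtVanishes 1 G (tensorObj R (TPow R X i) P) ∧
      TorVanishes R X 1 (tensorObj R (TPow R X i) G)

/-- `X` is co-compatible (with respect to the tensor ring `T_R(M)`). -/
def IsCocompatible : Prop :=
  ∀ I : CochainComplex (ModuleCat.{u} (TensorRing R M)ᵐᵒᵖ) ℤ, IsCompleteInjRes I →
    HomFromExact (ModuleCat.of Rᵐᵒᵖ X) (restrictComplexOp R M I) ∧
    ∀ E : ModuleCat.{u} Rᵐᵒᵖ, Injective E → HomFromExact (Coind R M (homObj X E)) I

/-- `X` is co-admissible. -/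
def IsCoadmissible : Prop :=
  ∀ H : ModuleCat.{u} Rᵐᵒᵖ, IsGorensteinInjective H → ∀ E : ModuleCat.{u} Rᵐᵒᵖ, Injective E →
    ∀ i : ℕ, ExtVanishes 1 (homObj (TPow R X i) E) H ∧
      ExtVanishes 1 (ModuleCat.of Rᵐᵒᵖ X) (homObj (TPow R X i) H)

end Bimodules

end

end GorTensor

/-! Write `A^∨` for the character module `Hom_ℤ(A, ℚ/ℤ)`. Every `Tor` is traded for an `Ext`:
`Tor_n(A, X) = 0` iff `Ext^n(X, A^∨) = 0` (`torVanishes_iff`), and balance of `Tor` becomes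
`Ext^n(X, A^∨) = 0 ↔ Ext^n(A, X^∨) = 0` (`extVanishes_lDual_iff`). Finite flat dimension of `M` on
the right then says that `M^∨` has finite injective dimension.

Two mechanisms drive part (1). The first is dimension shifting: if the terms of an acyclic complex
have no higher `Ext` into `W`, and `W` has finite injective dimension, then the cycles have none
either, since their `Ext` groups shift to arbitrarily high degree. For a complex of projective
`T`-modules, the terms restrict to retracts of coproducts of tensor powers `M^{⊗i}`, which (T) makes
acyclic for `M ⊗_R -`; hence `M ⊗_R Q` is exact. Over `R` the same shift, iterated over `i`, shows
that Gorenstein projective modules are acyclic for all tensor powers.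

The second is finite dimension: exactness of `Hom(Q, -)` on projectives extends to modules of finite
projective dimension. By (T) and `pd M < ∞`, tensoring with `M` keeps Tor-acyclic modules of finite
projective dimension in that class, so each `M^{⊗i} ⊗ P` has finite projective dimension. This gives
the `Ext` half of admissibility. `Ind` is exact on short exact sequences with Tor-acyclic quotient
and preserves projectives, so `Ind(M ⊗ P)` has a finite projective resolution over `T`; this gives
the `Hom` half of compatibility.

Part (2) is dual. Injective right modules are retracts of `F^∨` with `F` free, and `Hom(A, X^∨) ≅ (A
⊗ X)^∨`, so (T) becomes the vanishing of `Ext^n(M, Hom(M^{⊗i}, E))` for injective `E`, and finite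
flat dimension on the left bounds the injective dimension of `Hom(M, E)`. -/

namespace GorTensor

noncomputable section

open MulOpposite

/-! ### Vanishing of `Ext`: long exact sequences, coproducts, dimension shifting -/

section ExtToolkit

open Abelian

variable {R : Type u} [Ring R]

namespace ExtVanishes

variable {S : ShortComplex (ModuleCat.{u} R)} {X Y Z : ModuleCat.{u} R} {n : ℕ}

theorem of_forall (h : ∀ e : Ext X Y n, e = 0) : ExtVanishes n X Y :=
  ⟨fun a b => (h a).trans (h b).symm⟩

theorem eq_zero (h : ExtVanishes n X Y) (e : Ext X Y n) : e = 0 := h.elim _ _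

theorem of_retract_left (r : Retract X Y) (h : ExtVanishes n Y Z) : ExtVanishes n X Z :=
  of_forall fun x => by
    rw [← x.mk₀_id_comp, ← r.retract, ← Ext.mk₀_comp_mk₀, Ext.comp_assoc_of_second_deg_zero,
      h.eq_zero ((Ext.mk₀ r.r).comp x (zero_add n)), Ext.comp_zero]

theorem of_retract_right (r : Retract X Y) (h : ExtVanishes n Z Y) : ExtVanishes n Z X :=
  of_forall fun x => by
    rw [← x.comp_mk₀_id, ← r.retract, ← Ext.mk₀_comp_mk₀, ← Ext.comp_assoc_of_second_deg_zero,
      h.eq_zero (x.comp (Ext.mk₀ r.i) (add_zero n)), Ext.zero_comp]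

theorem of_iso_left (e : X ≅ Y) (h : ExtVanishes n Y Z) : ExtVanishes n X Z :=
  h.of_retract_left e.retract

theorem of_iso_right (e : X ≅ Y) (h : ExtVanishes n Z Y) : ExtVanishes n Z X :=
  h.of_retract_right e.retract

theorem of_projective [Projective X] : ExtVanishes (n + 1) X Y :=
  of_forall fun e => e.eq_zero_of_projective

theorem of_injective [Injective Y] : ExtVanishes (n + 1) X Y :=
  of_forall fun e => e.eq_zero_of_injective

theorem left_X₁ (hS : S.ShortExact) (h₂ : ExtVanishes n S.X₂ Y)
    (h₃ : ExtVanishes (n + 1) S.X₃ Y) : ExtVanishes n S.X₁ Y :=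
  of_forall fun x => by
    obtain ⟨y, rfl⟩ := Ext.contravariant_sequence_exact₁ hS _ x (add_comm 1 n) (h₃.eq_zero _)
    rw [h₂.eq_zero y, Ext.comp_zero]

theorem left_X₃ (hS : S.ShortExact) (h₁ : ExtVanishes n S.X₁ Y)
    (h₂ : ExtVanishes (n + 1) S.X₂ Y) : ExtVanishes (n + 1) S.X₃ Y :=
  of_forall fun x => by
    obtain ⟨y, rfl⟩ := Ext.contravariant_sequence_exact₃ hS _ x (h₂.eq_zero _) (add_comm 1 n)
    rw [h₁.eq_zero y, Ext.comp_zero]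

theorem right_X₃ (hS : S.ShortExact) (h₂ : ExtVanishes n X S.X₂)
    (h₁ : ExtVanishes (n + 1) X S.X₁) : ExtVanishes n X S.X₃ :=
  of_forall fun x => by
    obtain ⟨y, rfl⟩ := Ext.covariant_sequence_exact₃ _ hS x rfl (h₁.eq_zero _)
    rw [h₂.eq_zero y, Ext.zero_comp]

theorem right_X₁ (hS : S.ShortExact) (h₃ : ExtVanishes n X S.X₃)
    (h₂ : ExtVanishes (n + 1) X S.X₂) : ExtVanishes (n + 1) X S.X₁ :=
  of_forall fun x => by
    obtain ⟨y, rfl⟩ := Ext.covariant_sequence_exact₁ _ hS x (h₂.eq_zero _) rfl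
    rw [h₃.eq_zero y, Ext.zero_comp]

/-- The obstruction to extending `φ` is its image under the connecting map into `Ext^1(S.X₃, Y)`.
Together with `one_of_extension` this reduces statements about `Ext^1` to extension problems for
maps, which characters can handle. -/
theorem exists_extension (hS : S.ShortExact) (h : ExtVanishes 1 S.X₃ Y) (φ : S.X₁ ⟶ Y) :
    ∃ ψ : S.X₂ ⟶ Y, S.f ≫ ψ = φ := by
  obtain ⟨y, hy⟩ := Ext.contravariant_sequence_exact₁ hS _ (Ext.mk₀ φ) (add_zero 1) (h.eq_zero _)
  obtain ⟨ψ, rfl⟩ := Ext.homEquiv₀.symm.surjective y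
  exact ⟨ψ, Ext.homEquiv₀.symm.injective (by simpa using hy)⟩

theorem exists_lift (hS : S.ShortExact) (h : ExtVanishes 1 X S.X₁) (φ : X ⟶ S.X₃) :
    ∃ ψ : X ⟶ S.X₂, ψ ≫ S.g = φ := by
  obtain ⟨y, hy⟩ := Ext.covariant_sequence_exact₃ _ hS (Ext.mk₀ φ) (zero_add 1) (h.eq_zero _)
  obtain ⟨ψ, rfl⟩ := Ext.homEquiv₀.symm.surjective y
  exact ⟨ψ, Ext.homEquiv₀.symm.injective (by simpa using hy)⟩

theorem one_of_extension (hS : S.ShortExact) (h₂ : ExtVanishes 1 S.X₂ Y)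
    (h : ∀ φ : S.X₁ ⟶ Y, ∃ ψ : S.X₂ ⟶ Y, S.f ≫ ψ = φ) : ExtVanishes 1 S.X₃ Y :=
  of_forall fun x => by
    obtain ⟨y, rfl⟩ := Ext.contravariant_sequence_exact₃ hS _ x (h₂.eq_zero _) (add_zero 1)
    obtain ⟨φ, rfl⟩ := Ext.homEquiv₀.symm.surjective y
    obtain ⟨ψ, rfl⟩ := h φ
    simp [← Ext.mk₀_comp_mk₀]

theorem one_of_lift (hS : S.ShortExact) (h₂ : ExtVanishes 1 X S.X₂)
    (h : ∀ φ : X ⟶ S.X₃, ∃ ψ : X ⟶ S.X₂, ψ ≫ S.g = φ) : ExtVanishes 1 X S.X₁ :=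
  of_forall fun x => by
    obtain ⟨y, rfl⟩ := Ext.covariant_sequence_exact₁ _ hS x (h₂.eq_zero _) (zero_add 1)
    obtain ⟨φ, rfl⟩ := Ext.homEquiv₀.symm.surjective y
    obtain ⟨ψ, rfl⟩ := h φ
    simp [← Ext.mk₀_comp_mk₀]

end ExtVanishes

/-- A short exact sequence `0 → Y → J → C → 0` with `J` injective. -/
theorem exists_injective_shortExact (Y : ModuleCat.{u} R) :
    ∃ S : ShortComplex (ModuleCat.{u} R), S.ShortExact ∧ Injective S.X₂ ∧ S.X₁ = Y := by
  obtain ⟨p⟩ := EnoughInjectives.presentation Y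
  exact ⟨ShortComplex.mk _ _ (Limits.cokernel.condition p.f),
    { exact := ShortComplex.exact_cokernel p.f }, p.injective, rfl⟩

/-- A short exact sequence `0 → K → P → X → 0` with `P` projective. -/
theorem exists_projective_shortExact (X : ModuleCat.{u} R) :
    ∃ S : ShortComplex (ModuleCat.{u} R), S.ShortExact ∧ Projective S.X₂ ∧ S.X₃ = X := by
  obtain ⟨p⟩ := EnoughProjectives.presentation X
  exact ⟨ShortComplex.mk _ _ (Limits.kernel.condition p.f),
    { exact := ShortComplex.exact_kernel p.f }, p.projective, rfl⟩

/-- `X` is a coproduct of the family `F`, with inclusions `ι`. -/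
def IsCoprod {J : Type*} {F : J → ModuleCat.{u} R} {X : ModuleCat.{u} R} (ι : ∀ j, F j ⟶ X) :
    Prop :=
  ∀ (Y : ModuleCat.{u} R) (φ : ∀ j, F j ⟶ Y), ∃! Φ : X ⟶ Y, ∀ j, ι j ≫ Φ = φ j

/-- Embed `Y` in an injective with cokernel `C`. In degree one the maps into `C` must lift; lifts on
the summands assemble by the universal property. Higher degrees shift from `Y` to `C`. -/
theorem IsCoprod.extVanishes {J : Type*} {F : J → ModuleCat.{u} R} {X : ModuleCat.{u} R}
    {ι : ∀ j, F j ⟶ X} (hX : IsCoprod ι) {n : ℕ} {Y : ModuleCat.{u} R}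
    (h : ∀ j, ExtVanishes (n + 1) (F j) Y) : ExtVanishes (n + 1) X Y := by
  obtain ⟨S, hS, hJ, rfl⟩ := exists_injective_shortExact Y
  induction n generalizing S with
  | zero =>
    refine ExtVanishes.one_of_lift hS .of_injective fun φ => ?_
    choose ψ hψ using fun j => ExtVanishes.exists_lift hS (h j) (ι j ≫ φ)
    obtain ⟨Ψ, hΨ, -⟩ := hX _ ψ
    refine ⟨Ψ, (hX _ fun j => ι j ≫ φ).unique (fun j => ?_) fun j => rfl⟩
    rw [← Category.assoc, hΨ, hψ]
  | succ n ih =>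
    obtain ⟨S', hS', hJ', e⟩ := exists_injective_shortExact S.X₃
    refine ExtVanishes.right_X₁ hS ?_ .of_injective
    rw [← e]
    exact ih S' hS' hJ' fun j => e ▸ ExtVanishes.right_X₃ hS .of_injective (h j)

theorem hasProjectiveDimensionLT_iff_extVanishes (X : ModuleCat.{u} R) (n : ℕ) :
    HasProjectiveDimensionLT X n ↔ ∀ Y, ExtVanishes n X Y :=
  ⟨fun _ Y => HasProjectiveDimensionLT.subsingleton X n n le_rfl Y,
    fun h => hasProjectiveDimensionLT_of_enoughInjectives X n h⟩

theorem hasInjectiveDimensionLT_iff_extVanishes (X : ModuleCat.{u} R) (n : ℕ) :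
    HasInjectiveDimensionLT X n ↔ ∀ Y, ExtVanishes n Y X :=
  ⟨fun _ Y => HasInjectiveDimensionLT.subsingleton X n n le_rfl Y,
    fun h => hasInjectiveDimensionLT_of_enoughProjectives X n h⟩

/-- In a sequence of short exact sequences `0 → Z j → E j → Z (j + 1) → 0` with all
`Ext^{≥1}(E j, W) = 0`, the `Z j` inherit this property if `W` has finite injective dimension. -/
theorem extVanishes_of_coresolution {W : ModuleCat.{u} R} {d : ℕ} [HasInjectiveDimensionLT W d]
    {Z : ℕ → ModuleCat.{u} R} {S : ℕ → ShortComplex (ModuleCat.{u} R)}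
    (hS : ∀ j, (S j).ShortExact) (e₁ : ∀ j, (S j).X₁ ≅ Z j) (e₃ : ∀ j, (S j).X₃ ≅ Z (j + 1))
    (hE : ∀ j n, ExtVanishes (n + 1) (S j).X₂ W) (j n : ℕ) : ExtVanishes (n + 1) (Z j) W := by
  -- Here `k` bounds the number of shifts still needed: each one raises the degree by one and moves
  -- from `Z j` to `Z (j + 1)`, until the degree reaches `d`.
  have key : ∀ k j n, d ≤ n + 1 + k → ExtVanishes (n + 1) (Z j) W := by
    intro k
    induction k with
    | zero => exact fun j n h => HasInjectiveDimensionLT.subsingleton W d _ h _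
    | succ k ih =>
      exact fun j n h => (ExtVanishes.left_X₁ (hS j) (hE j n)
        ((ih (j + 1) (n + 1) (by omega)).of_iso_left (e₃ j))).of_iso_left (e₁ j).symm
  exact key d j n (by omega)

/-- Dimension shifting in the second variable: passing from `Z j` to the kernel `Z (j + 1)` raises
the degree, which eventually reaches the bound on the projective dimension of `W`. -/
theorem extVanishes_of_resolution {W : ModuleCat.{u} R} {d : ℕ} [HasProjectiveDimensionLT W d]
    {Z : ℕ → ModuleCat.{u} R} {S : ℕ → ShortComplex (ModuleCat.{u} R)}
    (hS : ∀ j, (S j).ShortExact) (e₁ : ∀ j, (S j).X₁ ≅ Z (j + 1)) (e₃ : ∀ j, (S j).X₃ ≅ Z j)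
    (hE : ∀ j n, ExtVanishes (n + 1) W (S j).X₂) (j n : ℕ) : ExtVanishes (n + 1) W (Z j) := by
  have key : ∀ k j n, d ≤ n + 1 + k → ExtVanishes (n + 1) W (Z j) := by
    intro k
    induction k with
    | zero => exact fun j n h => HasProjectiveDimensionLT.subsingleton W d _ h _
    | succ k ih =>
      exact fun j n h => (ExtVanishes.right_X₃ (hS j) (hE j n)
        ((ih (j + 1) (n + 1) (by omega)).of_iso_right (e₁ j))).of_iso_right (e₃ j).symm
  exact key d j n (by omega)

/-! ### Hom-exactness of complexes and `Ext^1` against their cycles -/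

section Complexes

variable {Q : CochainComplex (ModuleCat.{u} R) ℤ} {S : ShortComplex (ModuleCat.{u} R)}
  {Y : ModuleCat.{u} R}

theorem HomIntoExact.exists_extension (h : HomIntoExact Q Y) {i j k : ℤ} (hij : i + 1 = j)
    (hjk : j + 1 = k) (f : Q.X j ⟶ Y) (hf : Q.d i j ≫ f = 0) : ∃ g : Q.X k ⟶ Y, Q.d j k ≫ g = f := by
  obtain rfl : i = j - 1 := by omega
  subst hjk
  exact h j f hf

theorem HomFromExact.exists_lift (h : HomFromExact Y Q) {i j k : ℤ} (hij : i + 1 = j)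
    (hjk : j + 1 = k) (f : Y ⟶ Q.X j) (hf : f ≫ Q.d j k = 0) : ∃ g : Y ⟶ Q.X i, g ≫ Q.d i j = f := by
  obtain rfl : i = j - 1 := by omega
  subst hjk
  exact h j f hf

/-- Projectivity of the terms makes `Hom(Q, S)` a short exact sequence of complexes of groups, so
two exact ones force the third. The proof is the diagram chase. -/
theorem HomIntoExact.of_shortExact (hQ : ∀ j, Projective (Q.X j)) (hS : S.ShortExact)
    (h₁ : HomIntoExact Q S.X₁) (h₂ : HomIntoExact Q S.X₂) : HomIntoExact Q S.X₃ := by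
  intro j f hf
  have := hS.mono_f
  have := hS.epi_g
  have := hQ j
  let f' := Projective.factorThru f S.g
  have hf' : f' ≫ S.g = f := Projective.factorThru_comp f S.g
  -- The lift `f'` of `f` need not be a cocycle; its defect lands in `S.X₁` and is itself a cocycle
  -- there, so subtracting a preimage `k` corrects `f'`.
  let h := hS.exact.lift (Q.d (j - 1) j ≫ f') (by rw [Category.assoc, hf', hf])
  have hh : h ≫ S.f = Q.d (j - 1) j ≫ f' := hS.exact.lift_f _ _
  obtain ⟨k, hk⟩ := h₁.exists_extension (i := j - 2) (by omega) (sub_add_cancel j 1) h <| by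
    rw [← cancel_mono S.f, Category.assoc, hh, Q.d_comp_d_assoc, Limits.zero_comp, Limits.zero_comp]
  obtain ⟨g, hg⟩ := h₂ j (f' - k ≫ S.f) <| by
    rw [Preadditive.comp_sub, ← Category.assoc, hk, hh, sub_self]
  exact ⟨g ≫ S.g, by
    rw [← Category.assoc, hg, Preadditive.sub_comp, Category.assoc, S.zero, Limits.comp_zero,
      sub_zero, hf']⟩

theorem HomFromExact.of_shortExact (hQ : ∀ j, Injective (Q.X j)) (hS : S.ShortExact)
    (h₃ : HomFromExact S.X₃ Q) (h₂ : HomFromExact S.X₂ Q) : HomFromExact S.X₁ Q := by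
  intro j f hf
  have := hS.mono_f
  have := hS.epi_g
  have := hQ j
  let f' := Injective.factorThru f S.f
  have hf' : S.f ≫ f' = f := Injective.comp_factorThru f S.f
  -- The defect of the extension `f'` vanishes on `S.X₁`, hence comes from a cocycle on `S.X₃`.
  let h := hS.exact.desc (f' ≫ Q.d j (j + 1)) (by rw [← Category.assoc, hf', hf])
  have hh : S.g ≫ h = f' ≫ Q.d j (j + 1) := hS.exact.g_desc _ _
  obtain ⟨k, hk⟩ := h₃.exists_lift rfl (k := j + 1 + 1) rfl h <| by
    rw [← cancel_epi S.g, ← Category.assoc, hh, Category.assoc, Q.d_comp_d, Limits.comp_zero,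
      Limits.comp_zero]
  obtain ⟨g, hg⟩ := h₂ j (f' - S.g ≫ k) <| by
    rw [Preadditive.sub_comp, Category.assoc, hk, hh, sub_self]
  exact ⟨S.f ≫ g, by
    rw [Category.assoc, hg, Preadditive.comp_sub, ← Category.assoc, S.zero, Limits.zero_comp,
      sub_zero, hf']⟩

/-- To prove a property of all modules of finite projective dimension in a class `C`, it suffices
to prove it for projective modules and to pass to quotients in short exact sequences. -/
theorem projectiveDimension_induction {C p : ModuleCat.{u} R → Prop}
    (hC : ∀ S : ShortComplex (ModuleCat.{u} R), S.ShortExact → Projective S.X₂ → C S.X₃ → C S.X₁)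
    (h0 : ∀ P, Projective P → p P)
    (hp : ∀ S : ShortComplex (ModuleCat.{u} R), S.ShortExact → Projective S.X₂ → C S.X₃ →
      p S.X₁ → p S.X₂ → p S.X₃)
    {X : ModuleCat.{u} R} (hX : C X) (n : ℕ) (h : HasProjectiveDimensionLE X n) : p X := by
  induction n generalizing X with
  | zero => exact h0 X ((projective_iff_hasProjectiveDimensionLE_zero X).2 h)
  | succ n ih =>
    obtain ⟨S, hS, hP, rfl⟩ := exists_projective_shortExact X
    exact hp S hS hP hX (ih (hC S hS hP hX) ((hS.hasProjectiveDimensionLT_X₃_iff n hP).1 h))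
      (h0 _ hP)

/-- To prove a property of all modules of finite injective dimension in a class `C`, it suffices
to prove it for injective modules and to pass to kernels in short exact sequences. -/
theorem injectiveDimension_induction {C p : ModuleCat.{u} R → Prop}
    (hC : ∀ S : ShortComplex (ModuleCat.{u} R), S.ShortExact → Injective S.X₂ → C S.X₁ → C S.X₃)
    (h0 : ∀ P, Injective P → p P)
    (hp : ∀ S : ShortComplex (ModuleCat.{u} R), S.ShortExact → Injective S.X₂ → C S.X₁ →
      p S.X₃ → p S.X₂ → p S.X₁)
    {X : ModuleCat.{u} R} (hX : C X) (n : ℕ) (h : HasInjectiveDimensionLE X n) : p X := by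
  induction n generalizing X with
  | zero => exact h0 X (injective_iff_hasInjectiveDimensionLT_one.2 h)
  | succ n ih =>
    obtain ⟨S, hS, hP, rfl⟩ := exists_injective_shortExact X
    exact hp S hS hP hX (ih (hC S hS hP hX) ((hS.hasInjectiveDimensionLT_X₃_iff n hP).2 h))
      (h0 _ hP)

theorem IsCompleteProjRes.homIntoExact (hQ : IsCompleteProjRes Q) {n : ℕ}
    (h : HasProjectiveDimensionLE Y n) : HomIntoExact Q Y :=
  projectiveDimension_induction (C := fun _ => True) (fun _ _ _ _ => trivial) hQ.hom_exact
    (fun _ hS _ _ => .of_shortExact hQ.projective hS) trivial n h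

theorem IsCompleteInjRes.homFromExact (hQ : IsCompleteInjRes Q) {n : ℕ}
    (h : HasInjectiveDimensionLE Y n) : HomFromExact Y Q :=
  injectiveDimension_induction (C := fun _ => True) (fun _ _ _ _ => trivial) hQ.hom_exact
    (fun _ hS _ _ => .of_shortExact hQ.injective hS) trivial n h

variable (Q) in
/-- The kernel of the differential of `Q` in degree `j`. -/
def kerD (j : ℤ) : ModuleCat.{u} R := Limits.kernel (Q.d j (j + 1))

variable (Q) in
/-- The inclusion of the kernel of the differential in degree `j`. -/
def kerι (j : ℤ) : kerD Q j ⟶ Q.X j := Limits.kernel.ι _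

variable (Q) in
/-- The differential, as a map to the kernel of the next one. -/
def kerπ (j : ℤ) : Q.X j ⟶ kerD Q (j + 1) :=
  Limits.kernel.lift _ (Q.d j (j + 1)) (Q.d_comp_d _ _ _)

theorem kerπ_ι (j : ℤ) : kerπ Q j ≫ kerι Q (j + 1) = Q.d j (j + 1) :=
  Limits.kernel.lift_ι _ _ _

instance (j : ℤ) : Mono (kerι Q j) :=
  (inferInstance : Mono (Limits.kernel.ι (Q.d j (j + 1))))

theorem kerι_π (j : ℤ) : kerι Q j ≫ kerπ Q j = 0 := by
  rw [← cancel_mono (kerι Q (j + 1)), Category.assoc, kerπ_ι, Limits.zero_comp]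
  exact Limits.kernel.condition _

variable (Q) in
/-- The short complex `ker d_j → Q_j → ker d_{j+1}`. -/
abbrev kerDSeq (j : ℤ) : ShortComplex (ModuleCat.{u} R) := ShortComplex.mk _ _ (kerι_π (Q := Q) j)

theorem kerDSeq_shortExact (hQ : Q.Acyclic) (j : ℤ) : (kerDSeq Q j).ShortExact where
  mono_f := inferInstanceAs (Mono (kerι Q j))
  epi_g := by
    have h := hQ (j + 1)
    rw [HomologicalComplex.exactAt_iff' _ j (j + 1) (j + 1 + 1) (by simp) (by simp),
      ShortComplex.exact_iff_epi_kernel_lift] at h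
    exact h
  exact := by
    refine ShortComplex.exact_of_f_is_kernel _ (Limits.KernelFork.IsLimit.ofι' _ _ fun k hk => ?_)
    have hk' : k ≫ Q.d j (j + 1) = 0 := by
      rw [← kerπ_ι, ← Category.assoc, hk, Limits.zero_comp]
    exact ⟨Limits.kernel.lift _ k hk', Limits.kernel.lift_ι _ _ _⟩

theorem epi_kerπ (hQ : Q.Acyclic) (j : ℤ) : Epi (kerπ Q j) := (kerDSeq_shortExact hQ j).epi_g

/-- A map out of a cycle module, composed with the surjection from the preceding term, is a cocycle;
Hom-exactness extends it over the next term. As the terms are projective, this is the vanishing of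
`Ext^1`. -/
theorem HomIntoExact.extVanishes (hQ : Q.Acyclic) (hP : ∀ j, Projective (Q.X j))
    (h : HomIntoExact Q Y) (j : ℤ) : ExtVanishes 1 (kerD Q j) Y := by
  -- `ker d_j` is the quotient of `Q_{j-1}` by `ker d_{j-1}`, and the latter is covered by
  -- `Q_{j-2}`.
  obtain ⟨i, rfl⟩ : ∃ i, i + 1 + 1 = j := ⟨j - 2, by omega⟩
  have := hP (i + 1)
  have := epi_kerπ hQ i
  refine ExtVanishes.one_of_extension (kerDSeq_shortExact hQ (i + 1))
    (ExtVanishes.of_projective (X := Q.X (i + 1))) fun φ => ?_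
  obtain ⟨g, hg⟩ := h.exists_extension (i := i - 1) (by omega) rfl (kerπ Q i ≫ φ) <| by
    obtain ⟨k, rfl⟩ : ∃ k, k + 1 = i := ⟨i - 1, by omega⟩
    rw [add_sub_cancel_right, ← kerπ_ι, Category.assoc, ← Category.assoc (kerι Q (k + 1)),
      kerι_π, Limits.zero_comp, Limits.comp_zero]
  refine ⟨g, ?_⟩
  rw [← kerπ_ι, Category.assoc] at hg
  exact (cancel_epi _).1 hg

theorem HomFromExact.extVanishes (hQ : Q.Acyclic) (hI : ∀ j, Injective (Q.X j))
    (h : HomFromExact Y Q) (j : ℤ) : ExtVanishes 1 Y (kerD Q j) := by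
  have := hI j
  refine ExtVanishes.one_of_lift (kerDSeq_shortExact hQ j)
    (ExtVanishes.of_injective (Y := Q.X j)) fun φ => ?_
  obtain ⟨g, hg⟩ := h.exists_lift rfl rfl (φ ≫ kerι Q (j + 1)) <| by
    rw [← kerπ_ι, Category.assoc, ← Category.assoc (kerι Q (j + 1)),
      kerι_π, Limits.zero_comp, Limits.comp_zero]
  refine ⟨g, ?_⟩
  rw [← kerπ_ι, ← Category.assoc] at hg
  exact (cancel_mono _).1 hg

/-- A cocycle factors through the next cycle module, and `Ext^1` of the cycles one degree further on
obstructs its extension over the next term. No projectivity is needed, so this applies to restricted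
complexes. -/
theorem homIntoExact_of_extVanishes (hQ : Q.Acyclic) (h : ∀ j, ExtVanishes 1 (kerD Q j) Y) :
    HomIntoExact Q Y := by
  intro j f hf
  obtain ⟨i, rfl⟩ : ∃ i, i + 1 = j := ⟨j - 1, by omega⟩
  have hS := kerDSeq_shortExact hQ (i + 1)
  have := epi_kerπ hQ (i + 1)
  have := epi_kerπ hQ i
  let φ := hS.exact.desc f <| by
    rw [add_sub_cancel_right, ← kerπ_ι, Category.assoc] at hf
    rw [← cancel_epi (kerπ Q i), hf, Limits.comp_zero]
  have hφ : kerπ Q (i + 1) ≫ φ = f := hS.exact.g_desc _ _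
  obtain ⟨ψ, hψ⟩ := ExtVanishes.exists_extension (kerDSeq_shortExact hQ (i + 1 + 1)) (h _) φ
  exact ⟨ψ, by rw [← kerπ_ι, Category.assoc, hψ, hφ]⟩

theorem homFromExact_of_extVanishes (hQ : Q.Acyclic) (h : ∀ j, ExtVanishes 1 Y (kerD Q j)) :
    HomFromExact Y Q := by
  intro j f hf
  obtain ⟨i, rfl⟩ : ∃ i, i + 1 = j := ⟨j - 1, by omega⟩
  have hS := kerDSeq_shortExact hQ (i + 1)
  let φ := hS.exact.lift f <| by
    rw [← kerπ_ι, ← Category.assoc] at hf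
    rw [← cancel_mono (kerι Q (i + 1 + 1)), hf, Limits.zero_comp]
  have hφ : φ ≫ kerι Q (i + 1) = f := hS.exact.lift_f _ _
  obtain ⟨ψ, hψ⟩ := ExtVanishes.exists_lift (kerDSeq_shortExact hQ i) (h _) φ
  rw [add_sub_cancel_right]
  exact ⟨ψ, by rw [← kerπ_ι, ← Category.assoc, hψ, hφ]⟩

end Complexes

end ExtToolkit

/-! ### Characters with values in `ℚ/ℤ` -/

section Characters

/-- Characters extend along injections, as `ℚ/ℤ` is injective. -/
theorem exists_char_extension {A B : Type*} [AddCommGroup A] [AddCommGroup B] (f : A →+ B)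
    (hf : Function.Injective f) (χ : A →+ AddCircle (1 : ℚ)) :
    ∃ χ' : B →+ AddCircle (1 : ℚ), ∀ a, χ' (f a) = χ a := by
  obtain ⟨χ', h⟩ := CharacterModule.dual_surjective_of_injective f.toIntLinearMap hf χ
  exact ⟨χ', fun a => DFunLike.congr_fun h a⟩

theorem eq_zero_of_char {A : Type*} [AddCommGroup A] {a : A}
    (h : ∀ χ : A →+ AddCircle (1 : ℚ), χ a = 0) : a = 0 :=
  CharacterModule.eq_zero_of_character_apply fun χ => h χ

/-- Forward: a character killing the image descends to `B / ker g`, which embeds in `C`, and `ℚ/ℤ`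
is injective. Backward: `ℚ/ℤ` cogenerates, so an element of `ker g` outside the image would be
detected by a character of `B / im f`, yet every such character factors through `g`. -/
theorem exact_iff_char {A B C : Type*} [AddCommGroup A] [AddCommGroup B] [AddCommGroup C]
    (f : A →+ B) (g : B →+ C) (hfg : ∀ a, g (f a) = 0) :
    Function.Exact f g ↔ ∀ χ : B →+ AddCircle (1 : ℚ), (∀ a, χ (f a) = 0) →
      ∃ ψ : C →+ AddCircle (1 : ℚ), ∀ b, ψ (g b) = χ b := by
  constructor
  · intro h χ hχ
    have hker : g.ker ≤ χ.ker := fun b hb => by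
      obtain ⟨a, rfl⟩ := (h b).1 hb
      exact hχ a
    obtain ⟨ψ, hψ⟩ := exists_char_extension (QuotientAddGroup.kerLift g)
      (QuotientAddGroup.kerLift_injective g) (QuotientAddGroup.lift _ χ hker)
    exact ⟨ψ, fun b => hψ b⟩
  · intro h b
    refine ⟨fun hb => ?_, fun ⟨a, ha⟩ => ha ▸ hfg a⟩
    suffices (b : B ⧸ f.range) = 0 from (QuotientAddGroup.eq_zero_iff b).1 this
    refine eq_zero_of_char fun χ => ?_
    obtain ⟨ψ, hψ⟩ := h (χ.comp (QuotientAddGroup.mk' f.range)) fun a => by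
      rw [AddMonoidHom.comp_apply, QuotientAddGroup.mk'_apply,
        (QuotientAddGroup.eq_zero_iff (f a)).2 (AddMonoidHom.mem_range.2 ⟨a, rfl⟩), map_zero]
    have := hψ b
    rw [hb, map_zero] at this
    exact this.symm

end Characters

/-! ### Character modules and tensor-Hom adjunction -/

section Duals

variable (R : Type u) [Ring R]

/-- The character module of a right `R`-module, a left `R`-module. -/
def LDual (A : Type u) [AddCommGroup A] [Module Rᵐᵒᵖ A] : Type u := A →+ AddCircle (1 : ℚ)

/-- The character module of a left `R`-module, a right `R`-module. -/
def RDual (X : Type u) [AddCommGroup X] [Module R X] : Type u := X →+ AddCircle (1 : ℚ)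

variable (A B : Type u) [AddCommGroup A] [Module Rᵐᵒᵖ A] [AddCommGroup B] [Module Rᵐᵒᵖ B]
  (X Y : Type u) [AddCommGroup X] [Module R X] [AddCommGroup Y] [Module R Y]

instance : AddCommGroup (LDual R A) := inferInstanceAs (AddCommGroup (A →+ AddCircle (1 : ℚ)))
instance : AddCommGroup (RDual R X) := inferInstanceAs (AddCommGroup (X →+ AddCircle (1 : ℚ)))

instance : FunLike (LDual R A) A (AddCircle (1 : ℚ)) :=
  inferInstanceAs (FunLike (A →+ AddCircle (1 : ℚ)) A (AddCircle (1 : ℚ)))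
instance : FunLike (RDual R X) X (AddCircle (1 : ℚ)) :=
  inferInstanceAs (FunLike (X →+ AddCircle (1 : ℚ)) X (AddCircle (1 : ℚ)))

instance : AddMonoidHomClass (LDual R A) A (AddCircle (1 : ℚ)) :=
  inferInstanceAs (AddMonoidHomClass (A →+ AddCircle (1 : ℚ)) A (AddCircle (1 : ℚ)))
instance : AddMonoidHomClass (RDual R X) X (AddCircle (1 : ℚ)) :=
  inferInstanceAs (AddMonoidHomClass (X →+ AddCircle (1 : ℚ)) X (AddCircle (1 : ℚ)))

variable {R A B X Y}

@[ext] theorem LDual.ext {f g : LDual R A} (h : ∀ a, f a = g a) : f = g := DFunLike.ext _ _ h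
@[ext] theorem RDual.ext {f g : RDual R X} (h : ∀ a, f a = g a) : f = g := DFunLike.ext _ _ h

instance : Module R (LDual R A) where
  smul r f := f.comp (DistribSMul.toAddMonoidHom A (op r))
  one_smul f := by ext a; exact congrArg f (one_smul Rᵐᵒᵖ a)
  mul_smul r s f := by ext a; exact congrArg f (mul_smul (op s) (op r) a)
  smul_zero r := rfl
  smul_add r f g := rfl
  add_smul r s f := by ext a; exact (congrArg f (add_smul (op r) (op s) a)).trans (map_add f _ _)
  zero_smul f := by ext a; exact (congrArg f (zero_smul Rᵐᵒᵖ a)).trans (map_zero f)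

instance : Module Rᵐᵒᵖ (RDual R X) where
  smul r f := f.comp (DistribSMul.toAddMonoidHom X r.unop)
  one_smul f := by ext a; exact congrArg f (one_smul R a)
  mul_smul r s f := by ext a; exact congrArg f (mul_smul s.unop r.unop a)
  smul_zero r := rfl
  smul_add r f g := rfl
  add_smul r s f := by ext a; exact (congrArg f (add_smul r.unop s.unop a)).trans (map_add f _ _)
  zero_smul f := by ext a; exact (congrArg f (zero_smul R a)).trans (map_zero f)

/-- The dual of a homomorphism of right modules. -/
def LDual.map (f : A →ₗ[Rᵐᵒᵖ] B) : LDual R B →ₗ[R] LDual R A where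
  toFun χ := AddMonoidHom.comp χ f.toAddMonoidHom
  map_add' _ _ := rfl
  map_smul' r χ := by ext a; exact congrArg χ (map_smul f (op r) a).symm

/-- The dual of a homomorphism of left modules. -/
def RDual.map (f : X →ₗ[R] Y) : RDual R Y →ₗ[Rᵐᵒᵖ] RDual R X where
  toFun χ := AddMonoidHom.comp χ f.toAddMonoidHom
  map_add' _ _ := rfl
  map_smul' r χ := by ext a; exact congrArg χ (map_smul f r.unop a).symm

/-- `Hom_R(X, A^∨) ≃ Hom_{Rᵒᵖ}(A, X^∨)`. -/
def homDualEquiv : (X →ₗ[R] LDual R A) ≃ (A →ₗ[Rᵐᵒᵖ] RDual R X) where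
  toFun φ :=
    { toFun := fun a => AddMonoidHom.mk' (fun x => φ x a) fun x y => by
        rw [map_add]; rfl
      map_add' := fun a b => by ext x; exact map_add (φ x) a b
      map_smul' := fun r a => by
        ext x; exact (DFunLike.congr_fun (map_smul φ r.unop x) a).symm }
  invFun ψ :=
    { toFun := fun x => AddMonoidHom.mk' (fun a => ψ a x) fun a b => by
        rw [map_add]; rfl
      map_add' := fun x y => by ext a; exact map_add (ψ a) x y
      map_smul' := fun r x => by
        ext a; exact (DFunLike.congr_fun (map_smul ψ (op r) a) x).symm }
  left_inv _ := rfl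
  right_inv _ := rfl

/-- `Hom_R(X, A^∨) ≃ (A ⊗_R X)^∨`. -/
def charTensorEquiv : (X →ₗ[R] LDual R A) ≃ (NTensor R A X →+ AddCircle (1 : ℚ)) where
  toFun φ := NTensor.lift
    (AddMonoidHom.mk' (fun a => AddMonoidHom.mk' (fun x => φ x a) fun x y => by
        rw [map_add]; rfl)
      fun a b => by ext x; exact map_add (φ x) a b)
    fun a r x => (DFunLike.congr_fun (map_smul φ r x) a).symm
  invFun χ :=
    { toFun := fun x => AddMonoidHom.mk' (fun a => χ (NTensor.tmul R a x)) fun a b => by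
        rw [NTensor.add_tmul, map_add]
      map_add' := fun x y => by
        ext a; exact (congrArg χ (NTensor.tmul_add a x y)).trans (map_add χ _ _)
      map_smul' := fun r x => by
        ext a; exact congrArg χ (NTensor.smul_tmul a r x).symm }
  left_inv _ := rfl
  right_inv χ := NTensor.addHom_ext fun _ _ => rfl

theorem charTensorEquiv_map (φ : Y →ₗ[R] LDual R A) (f : X →ₗ[R] Y) (z : NTensor R A X) :
    charTensorEquiv φ (NTensor.map LinearMap.id f z) = charTensorEquiv (φ.comp f) z :=
  DFunLike.congr_fun (NTensor.addHom_ext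
    (f := (charTensorEquiv φ).comp (NTensor.map LinearMap.id f))
    (g := charTensorEquiv (φ.comp f)) fun _ _ => rfl) z

/-- Exactness of `A ⊗_R X → A ⊗_R Y → A ⊗_R Z` is exactness of the sequence of homomorphisms into
the character module of `A`. -/
theorem tensor_exact_iff {Z : Type u} [AddCommGroup Z] [Module R Z] (f : X →ₗ[R] Y) (g : Y →ₗ[R] Z)
    (hfg : g.comp f = 0) :
    Function.Exact (NTensor.map (LinearMap.id (M := A)) f) (NTensor.map (LinearMap.id (M := A)) g) ↔
      ∀ φ : Y →ₗ[R] LDual R A, φ.comp f = 0 → ∃ ψ : Z →ₗ[R] LDual R A, ψ.comp g = φ := by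
  rw [exact_iff_char]
  · rw [charTensorEquiv.symm.surjective.forall]
    have h0 : ∀ χ : NTensor R A Y →+ AddCircle (1 : ℚ),
        (∀ z, χ (NTensor.map (LinearMap.id (M := A)) f z) = 0) ↔
          (charTensorEquiv.symm χ).comp f = 0 := by
      refine fun χ => ⟨fun h => ?_, fun h z => ?_⟩
      · ext x a
        exact h (NTensor.tmul R a x)
      · obtain ⟨φ, rfl⟩ := charTensorEquiv.surjective χ
        rw [Equiv.symm_apply_apply] at h
        rw [charTensorEquiv_map, h]
        exact DFunLike.congr_fun (NTensor.addHom_ext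
          (f := charTensorEquiv (0 : X →ₗ[R] LDual R A)) (g := 0) fun _ _ => rfl) z
    refine forall_congr' fun χ => ?_
    rw [h0]
    refine imp_congr_right fun _ => ⟨fun ⟨ψ, hψ⟩ => ⟨charTensorEquiv.symm ψ, ?_⟩, fun ⟨ψ, hψ⟩ =>
      ⟨charTensorEquiv ψ, fun z => ?_⟩⟩
    · ext x a
      exact hψ (NTensor.tmul R a x)
    · rw [charTensorEquiv_map, hψ, Equiv.apply_symm_apply]
  · exact fun z => DFunLike.congr_fun (NTensor.addHom_ext
      (f := (NTensor.map (LinearMap.id (M := A)) g).comp (NTensor.map LinearMap.id f)) (g := 0)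
      fun a x => by
        change NTensor.tmul R a (g.comp f x) = 0
        rw [hfg]; exact NTensor.tmul_zero a) z

end Duals

/-! ### `Tor` as `Ext` into character modules; balance and dimensions -/

section DualExt

variable {R : Type u} [Ring R]

/-- The character module of a right module, as an object of `ModuleCat R`. -/
abbrev lDual (A : ModuleCat.{u} Rᵐᵒᵖ) : ModuleCat.{u} R := ModuleCat.of R (LDual R A)

/-- The character module of a left module, as an object of `ModuleCat Rᵐᵒᵖ`. -/
abbrev rDual (X : ModuleCat.{u} R) : ModuleCat.{u} Rᵐᵒᵖ := ModuleCat.of Rᵐᵒᵖ (RDual R X)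

/-- The dual of a short complex of right modules. -/
abbrev lDualSeq (S : ShortComplex (ModuleCat.{u} Rᵐᵒᵖ)) : ShortComplex (ModuleCat.{u} R) :=
  ShortComplex.mk (X₁ := lDual S.X₃) (X₂ := lDual S.X₂) (X₃ := lDual S.X₁)
    (ModuleCat.ofHom (LDual.map S.g.hom)) (ModuleCat.ofHom (LDual.map S.f.hom)) (by
      ext χ
      refine LDual.ext (R := R) fun a => ?_
      change χ ((S.f ≫ S.g).hom a) = 0
      rw [S.zero]
      exact map_zero χ)

theorem lDualSeq_shortExact {S : ShortComplex (ModuleCat.{u} Rᵐᵒᵖ)} (hS : S.ShortExact) :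
    (lDualSeq S).ShortExact := by
  refine ModuleCat.shortComplex_shortExact _ ?_ ?_ ?_
  · have hex := (ShortComplex.ShortExact.moduleCat_exact_iff_function_exact _).1 hS.exact
    have := (exact_iff_char S.f.hom.toAddMonoidHom S.g.hom.toAddMonoidHom
      fun a => hex.apply_apply_eq_zero a).1 hex
    intro χ
    constructor
    · intro h
      obtain ⟨ψ, hψ⟩ := this χ fun a => DFunLike.congr_fun h a
      exact ⟨ψ, LDual.ext (R := R) hψ⟩
    · rintro ⟨ψ, rfl⟩
      refine LDual.ext (R := R) fun a => ?_
      change ψ (S.g.hom (S.f.hom a)) = 0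
      rw [hex.apply_apply_eq_zero a]
      exact map_zero ψ
  · intro χ χ' h
    refine LDual.ext (R := R) fun c => ?_
    obtain ⟨b, rfl⟩ := hS.moduleCat_surjective_g c
    exact DFunLike.congr_fun h b
  · intro χ
    obtain ⟨χ', h⟩ := exists_char_extension S.f.hom.toAddMonoidHom hS.moduleCat_injective_f χ
    exact ⟨χ', LDual.ext (R := R) h⟩

/-- Maps `X → P^∨` are maps `P → X^∨`, and `Y^∨ → X^∨` is surjective, so projectivity of `P` gives
the extension. -/
theorem exists_dual_extension_left {X Y : ModuleCat.{u} R} (f : X ⟶ Y) [Mono f]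
    {P : ModuleCat.{u} Rᵐᵒᵖ} [Projective P] (φ : X ⟶ lDual P) : ∃ ψ : Y ⟶ lDual P, f ≫ ψ = φ := by
  have hs : Function.Surjective (RDual.map f.hom) := fun χ => by
    obtain ⟨χ', h⟩ := exists_char_extension f.hom.toAddMonoidHom
      ((ModuleCat.mono_iff_injective f).1 inferInstance) χ
    exact ⟨χ', RDual.ext (R := R) h⟩
  let p : rDual Y ⟶ rDual X := ModuleCat.ofHom (RDual.map f.hom)
  have : Epi p := (ModuleCat.epi_iff_surjective p).2 hs
  let θ : P ⟶ rDual X := ModuleCat.ofHom (homDualEquiv φ.hom)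
  refine ⟨ModuleCat.ofHom (homDualEquiv.symm (Projective.factorThru θ p).hom), ?_⟩
  ext a
  refine LDual.ext (R := R) fun x => ?_
  exact DFunLike.congr_fun (congrArg (fun t => t.hom x) (Projective.factorThru_comp θ p)) a

instance (P : ModuleCat.{u} Rᵐᵒᵖ) [Projective P] : Injective (lDual P) :=
  ⟨fun φ f _ => exists_dual_extension_left f φ⟩

/-- Maps `X → F^∨` are characters of `F ⊗ X`, and these extend along the injection that flatness
provides. -/
theorem IsFlatRight.injective_lDual {F : ModuleCat.{u} Rᵐᵒᵖ} (hF : IsFlatRight (R := R) F) :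
    Injective (lDual F) where
  factors {X Y} φ f _ := by
    obtain ⟨χ, hχ⟩ := exists_char_extension _
      (hF X Y f.hom ((ModuleCat.mono_iff_injective f).1 inferInstance)) (charTensorEquiv φ.hom)
    refine ⟨ModuleCat.ofHom (charTensorEquiv.symm χ), ?_⟩
    ext x
    exact LDual.ext (R := R) fun a => hχ (NTensor.tmul R a x)

theorem IsFlatLeft.injective_rDual {F : ModuleCat.{u} R} (hF : IsFlatLeft F) :
    Injective (rDual F) where
  factors {A B} φ f _ := by
    obtain ⟨χ, hχ⟩ := exists_char_extension _
      (hF A B f.hom ((ModuleCat.mono_iff_injective f).1 inferInstance))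
      (charTensorEquiv (homDualEquiv.symm φ.hom))
    refine ⟨ModuleCat.ofHom (homDualEquiv (charTensorEquiv.symm χ)), ?_⟩
    ext a
    exact RDual.ext (R := R) fun x => hχ (NTensor.tmul R a x)

/-- Balance of `Tor`, on the level of character modules. -/
theorem extVanishes_lDual_iff (n : ℕ) (X : ModuleCat.{u} R) (A : ModuleCat.{u} Rᵐᵒᵖ) :
    ExtVanishes (n + 1) X (lDual A) ↔ ExtVanishes (n + 1) A (rDual X) := by
  obtain ⟨S, hS, hP, rfl⟩ := exists_projective_shortExact A
  have hD := lDualSeq_shortExact hS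
  have hJ : Injective (lDual S.X₂) := inferInstance
  -- In degree one, lifting maps `X → (S.X₁)^∨` to `(S.X₂)^∨` and extending maps `S.X₁ → X^∨` over
  -- `S.X₂` are the same problem under `homDualEquiv`. Higher degrees shift to the syzygy `S.X₁` of
  -- `A`.
  induction n generalizing S with
  | zero =>
    constructor
    · intro h
      refine ExtVanishes.one_of_extension hS .of_projective fun φ => ?_
      obtain ⟨ψ, hψ⟩ := ExtVanishes.exists_lift hD h (ModuleCat.ofHom (homDualEquiv.symm φ.hom))
      refine ⟨ModuleCat.ofHom (homDualEquiv ψ.hom), ?_⟩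
      ext a
      exact RDual.ext (R := R) fun x => DFunLike.congr_fun (congrArg (fun t => t.hom x) hψ) a
    · intro h
      refine ExtVanishes.one_of_lift hD (.of_injective (Y := lDual S.X₂)) fun φ => ?_
      obtain ⟨ψ, hψ⟩ := ExtVanishes.exists_extension hS h (ModuleCat.ofHom (homDualEquiv φ.hom))
      refine ⟨ModuleCat.ofHom (homDualEquiv.symm ψ.hom), ?_⟩
      ext x
      exact LDual.ext (R := R) fun a => DFunLike.congr_fun (congrArg (fun t => t.hom a) hψ) x
  | succ n ih =>
    obtain ⟨S', hS', hP', e⟩ := exists_projective_shortExact S.X₁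
    have h := ih S' hS' hP' (lDualSeq_shortExact hS') inferInstance
    rw [e] at h
    exact ⟨fun H => ExtVanishes.left_X₃ hS
        (h.1 (ExtVanishes.right_X₃ hD (.of_injective (Y := lDual S.X₂)) H)) .of_projective,
      fun H => ExtVanishes.right_X₁ hD
        (h.2 (ExtVanishes.left_X₁ hS .of_projective H)) (.of_injective (Y := lDual S.X₂))⟩

/-- Characters turn a flat resolution into an injective coresolution of the same length. -/
theorem hasInjectiveDimensionLE_lDual_of_resolution (n : ℕ) (A : ModuleCat.{u} Rᵐᵒᵖ)
    (h : HasResolutionOfLength (IsFlatRight (R := R)) n A) :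
    HasInjectiveDimensionLE (lDual A) n := by
  induction n generalizing A with
  | zero => exact injective_iff_hasInjectiveDimensionLT_one.1 (IsFlatRight.injective_lDual h)
  | succ n ih =>
    obtain ⟨F, f, hF, hf, hK⟩ := h
    have hJ := hF.injective_lDual
    exact ((lDualSeq_shortExact
      (LinearMap.shortExact_shortComplexKer hf)).hasInjectiveDimensionLT_X₃_iff n hJ).1 (ih _ hK)

/-- The counterpart for left modules. Balance moves `X` to the first variable of `Ext`, where the
flat resolution can be shifted along without dualizing it. -/
theorem extVanishes_rDual_of_resolution (n : ℕ) (X : ModuleCat.{u} R)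
    (h : HasResolutionOfLength IsFlatLeft n X) (A : ModuleCat.{u} Rᵐᵒᵖ) (k : ℕ) (hk : n < k) :
    ExtVanishes k A (rDual X) := by
  induction n generalizing X k with
  | zero =>
    obtain ⟨k, rfl⟩ := Nat.exists_eq_add_of_lt hk
    have := IsFlatLeft.injective_rDual h
    exact .of_injective
  | succ n ih =>
    obtain ⟨F, f, hF, hf, hK⟩ := h
    obtain ⟨k, rfl⟩ : ∃ l, k = l + 1 + 1 := ⟨k - 2, by omega⟩
    have hJ := hF.injective_rDual
    rw [← extVanishes_lDual_iff]
    exact ExtVanishes.left_X₃ (LinearMap.shortExact_shortComplexKer hf)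
      ((extVanishes_lDual_iff _ _ _).2 (ih _ hK _ (by omega)))
      ((extVanishes_lDual_iff _ _ _).2 (.of_injective (Y := rDual F)))

/-- `Tor_n^R(A, X) = 0` if and only if `Ext^n_R(X, A^∨) = 0`. -/
theorem torVanishes_iff (A : Type u) [AddCommGroup A] [Module Rᵐᵒᵖ A] (n : ℕ)
    (X : ModuleCat.{u} R) :
    TorVanishes R A (n + 1) X ↔ ExtVanishes (n + 1) X (ModuleCat.of R (LDual R A)) := by
  let P := projectiveResolution X
  rw [TorVanishes, (P.isoLeftDerivedObj (tensorFunctor R A) (n + 1)).isZero_iff]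
  change Limits.IsZero (HomologicalComplex.homology _ (n + 1)) ↔ _
  rw [← HomologicalComplex.exactAt_iff_isZero_homology,
    HomologicalComplex.exactAt_iff' _ (n + 1 + 1) (n + 1) n (by simp) (by simp),
    ShortComplex.ab_exact_iff_function_exact]
  -- By duality, exactness of `A ⊗ P` in degree `n + 1` says that every cocycle `P_{n+1} → A^∨` is a
  -- coboundary, which is the vanishing of `Ext^{n+1}` computed from the resolution `P`.
  refine (tensor_exact_iff (A := A) (P.complex.d (n + 1 + 1) (n + 1)).hom
    (P.complex.d (n + 1) n).hom ?_).trans ?_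
  · rw [← ModuleCat.hom_comp, P.complex.d_comp_d]; rfl
  · constructor
    · intro h
      refine ExtVanishes.of_forall fun e => ?_
      obtain ⟨f, hf, rfl⟩ := P.extMk_surjective e (n + 1 + 1) rfl
      rw [P.extMk_eq_zero_iff _ _ _ _ n rfl]
      obtain ⟨ψ, hψ⟩ := h f.hom (congrArg ModuleCat.Hom.hom hf)
      exact ⟨ModuleCat.ofHom ψ, ModuleCat.hom_ext hψ⟩
    · intro h φ hφ
      have h0 : P.complex.d (n + 1 + 1) (n + 1) ≫
          ModuleCat.ofHom (X := P.complex.X (n + 1)) (Y := LDual R A) φ = 0 := ModuleCat.hom_ext hφ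
      obtain ⟨g, hg⟩ := (P.extMk_eq_zero_iff _ (n + 1 + 1) rfl h0 n rfl).1 (h.eq_zero _)
      exact ⟨g.hom, congrArg ModuleCat.Hom.hom hg⟩

/-- Every injective right module is a retract of the character module of a free left module. -/
theorem exists_retract_rDual (I : ModuleCat.{u} Rᵐᵒᵖ) [Injective I] :
    ∃ J : Type u, Nonempty (Retract I (rDual (ModuleCat.of R (J →₀ R)))) := by
  let p : (lDual I →₀ R) →ₗ[R] lDual I := Finsupp.linearCombination R id
  have hp : Function.Surjective p := Finsupp.linearCombination_id_surjective R _
  let i : I ⟶ rDual (ModuleCat.of R (lDual I →₀ R)) := ModuleCat.ofHom (homDualEquiv p)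
  have : Mono i := by
    refine (ModuleCat.mono_iff_injective i).2 ((injective_iff_map_eq_zero _).2 fun a ha => ?_)
    refine eq_zero_of_char fun χ => ?_
    obtain ⟨y, hy⟩ := hp χ
    have := DFunLike.congr_fun ha y
    change p y a = 0 at this
    rwa [hy] at this
  exact ⟨lDual I, ⟨⟨i, Injective.factorThru (𝟙 I) i, Injective.comp_factorThru _ _⟩⟩⟩

/-- Every projective module is a retract of a free module. -/
theorem exists_retract_free (P : ModuleCat.{u} R) [Projective P] :
    ∃ J : Type u, Nonempty (Retract P (ModuleCat.of R (J →₀ R))) := by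
  let p : ModuleCat.of R (P →₀ R) ⟶ P := ModuleCat.ofHom (Finsupp.linearCombination R id)
  have : Epi p := (ModuleCat.epi_iff_surjective p).2 (Finsupp.linearCombination_id_surjective R _)
  exact ⟨P, ⟨⟨Projective.factorThru (𝟙 P) p, p, Projective.factorThru_comp _ _⟩⟩⟩

end DualExt

/-! ### The functors `M^{⊗i} ⊗_R -` -/

section TensorFunctor

variable {R : Type u} [Ring R]

section

variable (S A : Type u) [Ring S] [AddCommGroup A] [Module S A] [Module Rᵐᵒᵖ A]
  [SMulCommClass S Rᵐᵒᵖ A] {X Y : Type u} [AddCommGroup X] [Module R X] [AddCommGroup Y]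
  [Module R Y]

/-- The `S`-linear map `A ⊗_R X → A ⊗_R Y` induced by `f : X → Y`. -/
def NTensor.lTensor (f : X →ₗ[R] Y) : NTensor R A X →ₗ[S] NTensor R A Y where
  toFun := NTensor.map LinearMap.id f
  map_add' := map_add _
  map_smul' s z := by
    induction z using NTensor.induction_on with
    | h0 => simp
    | ht a x => rfl
    | ha y z hy hz => rw [smul_add, map_add, hy, hz, map_add, smul_add]

theorem NTensor.linearHom_ext {B : Type*} [AddCommGroup B] [Module S B]
    {f g : NTensor R A X →ₗ[S] B} (h : ∀ a x, f (NTensor.tmul R a x) = g (NTensor.tmul R a x)) :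
    f = g :=
  LinearMap.toAddMonoidHom_injective (NTensor.addHom_ext h)

variable (R) in
/-- The functor `A ⊗_R -` from left `R`-modules to left `S`-modules. -/
def tensF : ModuleCat.{u} R ⥤ ModuleCat.{u} S where
  obj X := tensorObj S A X
  map f := ModuleCat.ofHom (NTensor.lTensor S A f.hom)
  map_id _ := ModuleCat.hom_ext (NTensor.linearHom_ext S A fun _ _ => rfl)
  map_comp _ _ := ModuleCat.hom_ext (NTensor.linearHom_ext S A fun _ _ => rfl)

instance : (tensF R S A).Additive where
  map_add {_ _ f g} := ModuleCat.hom_ext (NTensor.linearHom_ext S A fun a x =>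
    NTensor.tmul_add a (f.hom x) (g.hom x))

theorem NTensor.lTensor_surjective (f : X →ₗ[R] Y) (hf : Function.Surjective f) :
    Function.Surjective (NTensor.lTensor S A f) := fun z => by
  induction z using NTensor.induction_on with
  | h0 => exact ⟨0, map_zero _⟩
  | ht a y =>
    obtain ⟨x, rfl⟩ := hf y
    exact ⟨NTensor.tmul R a x, rfl⟩
  | ha y z hy hz =>
    obtain ⟨y, rfl⟩ := hy
    obtain ⟨z, rfl⟩ := hz
    exact ⟨y + z, map_add _ _ _⟩

/-- `A ⊗_R -` preserves a short exact sequence `0 → X₁ → X₂ → X₃ → 0` if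
`Tor_1(A, X₃) = 0`. -/
theorem tensF_shortExact {C : ShortComplex (ModuleCat.{u} R)} (hC : C.ShortExact)
    (h : ExtVanishes 1 C.X₃ (ModuleCat.of R (LDual R A))) : (C.map (tensF R S A)).ShortExact := by
  have hex := (ShortComplex.ShortExact.moduleCat_exact_iff_function_exact _).1 hC.exact
  refine ModuleCat.shortComplex_shortExact _ ?_ ?_
    (NTensor.lTensor_surjective S A C.g.hom hC.moduleCat_surjective_g)
  · refine (tensor_exact_iff (A := A) C.f.hom C.g.hom hex.linearMap_comp_eq_zero).2 fun φ hφ => ?_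
    have := hC.epi_g
    have h0 : C.f ≫ ModuleCat.ofHom (X := C.X₂) (Y := LDual R A) φ = 0 := ModuleCat.hom_ext hφ
    exact ⟨(hC.exact.desc _ h0).hom, congrArg ModuleCat.Hom.hom (hC.exact.g_desc _ h0)⟩
  · refine (injective_iff_map_eq_zero (NTensor.lTensor S A C.f.hom)).2 fun z hz =>
      eq_zero_of_char fun χ => ?_
    obtain ⟨ψ, hψ⟩ := ExtVanishes.exists_extension hC h
      (ModuleCat.ofHom (charTensorEquiv.symm χ))
    have hψ' : ψ.hom.comp C.f.hom = charTensorEquiv.symm χ := congrArg ModuleCat.Hom.hom hψ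
    have := charTensorEquiv_map ψ.hom C.f.hom z
    rw [hψ', Equiv.apply_symm_apply] at this
    rw [← this]
    exact (congrArg (charTensorEquiv ψ.hom) hz).trans (map_zero _)

end

section

variable (X : Type u) [AddCommGroup X] [Module R X]

/-- `R ⊗_R X ≃ X`. -/
def NTensor.lid : NTensor R R X ≃ₗ[R] X where
  toFun := NTensor.lift (AddMonoidHom.mk' (fun r => DistribSMul.toAddMonoidHom X r)
    fun r s => by ext x; exact add_smul r s x) fun a r x => mul_smul a r x
  map_add' := map_add _
  map_smul' s z := by
    induction z using NTensor.induction_on with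
    | h0 => simp
    | ht a x => exact mul_smul s a x
    | ha y z hy hz => rw [smul_add, map_add, hy, hz, map_add, smul_add]
  invFun x := NTensor.tmul R 1 x
  left_inv z := DFunLike.congr_fun (NTensor.addHom_ext
    (f := (AddMonoidHom.mk' (fun x => NTensor.tmul R (1 : R) x)
      fun x y => NTensor.tmul_add 1 x y).comp (NTensor.lift (AddMonoidHom.mk'
        (fun r => DistribSMul.toAddMonoidHom X r) fun r s => by ext x; exact add_smul r s x)
          fun a r x => mul_smul a r x))
    (g := AddMonoidHom.id _) fun r x => by
      change NTensor.tmul R (1 : R) (r • x) = NTensor.tmul R r x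
      rw [← NTensor.smul_tmul]
      exact congrArg (NTensor.tmul R · x) (one_mul r)) z
  right_inv x := one_smul R x

variable (M B : Type u) [AddCommGroup M] [Module Rᵐᵒᵖ M]
  [AddCommGroup B] [Module R B] [Module Rᵐᵒᵖ B] [SMulCommClass R Rᵐᵒᵖ B]

attribute [local instance] NTensor.rightModule

variable {X} in
/-- The map `b ↦ b ⊗ x`. -/
def NTensor.tmulRight (x : X) : B →ₗ[R] NTensor R B X where
  toFun b := NTensor.tmul R b x
  map_add' a b := NTensor.add_tmul a b x
  map_smul' _ _ := rfl

/-- `m ⊗ b ↦ m ⊗ (b ⊗ x)`. -/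
def NTensor.assocAux : NTensor R M B →+ X →+ NTensor R M (NTensor R B X) :=
  AddMonoidHom.mk' (fun z => AddMonoidHom.mk'
      (fun x => NTensor.map LinearMap.id (NTensor.tmulRight B x) z) fun x y => by
      induction z using NTensor.induction_on with
      | h0 => simp
      | ht m b =>
        exact (congrArg (NTensor.tmul R m) (NTensor.tmul_add b x y)).trans (NTensor.tmul_add m _ _)
      | ha y z hy hz => simp only [map_add, hy, hz]; abel)
    fun y z => by ext x; exact map_add (NTensor.map LinearMap.id (NTensor.tmulRight B x)) y z

theorem NTensor.assocAux_smul (z : NTensor R M B) (r : R) (x : X) :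
    NTensor.assocAux X M B (op r • z) x = NTensor.assocAux X M B z (r • x) := by
  induction z using NTensor.induction_on with
  | h0 => simp
  | ht m b => exact congrArg (NTensor.tmul R m) (NTensor.smul_tmul b r x)
  | ha y z hy hz => simp only [smul_add, map_add, AddMonoidHom.add_apply, hy, hz]

/-- `m ⊗ (b ⊗ x) ↦ (m ⊗ b) ⊗ x`. -/
def NTensor.assocInv : NTensor R M (NTensor R B X) →+ NTensor R (NTensor R M B) X :=
  NTensor.lift (AddMonoidHom.mk' (fun m => NTensor.map
      ({ toFun := fun b => NTensor.tmul R m b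
         map_add' := fun a b => NTensor.tmul_add m a b
         map_smul' := fun _ _ => rfl } : B →ₗ[Rᵐᵒᵖ] NTensor R M B) LinearMap.id)
      fun m n => NTensor.addHom_ext fun b x =>
        (congrArg (NTensor.tmul R · x) (NTensor.add_tmul m n b)).trans (NTensor.add_tmul _ _ x))
    fun m r z => by
      induction z using NTensor.induction_on with
      | h0 => simp
      | ht b x => exact congrArg (NTensor.tmul R · x) (NTensor.smul_tmul m r b)
      | ha y z hy hz => simp only [smul_add, map_add, hy, hz]

/-- `(M ⊗_R B) ⊗_R X ≃ M ⊗_R (B ⊗_R X)`. -/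
def NTensor.assoc : NTensor R (NTensor R M B) X ≃+ NTensor R M (NTensor R B X) :=
  AddMonoidHom.toAddEquiv (NTensor.lift (NTensor.assocAux X M B) (NTensor.assocAux_smul X M B))
    (NTensor.assocInv X M B)
    (NTensor.addHom_ext fun z x => by
      induction z using NTensor.induction_on with
      | h0 => simp [NTensor.zero_tmul]
      | ht m b => rfl
      | ha y z hy hz => rw [NTensor.add_tmul, map_add, map_add, hy, hz])
    (NTensor.addHom_ext fun m z => by
      induction z using NTensor.induction_on with
      | h0 => simp [NTensor.tmul_zero]
      | ht m b => rfl
      | ha y z hy hz => rw [NTensor.tmul_add, map_add, map_add, hy, hz])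

theorem NTensor.assoc_addHom_ext {D : Type*} [AddCommGroup D]
    {f g : NTensor R (NTensor R M B) X →+ D}
    (h : ∀ m b x, f (NTensor.tmul R (NTensor.tmul R m b) x) =
      g (NTensor.tmul R (NTensor.tmul R m b) x)) : f = g :=
  NTensor.addHom_ext fun z x => by
    induction z using NTensor.induction_on with
    | h0 => simp [NTensor.zero_tmul]
    | ht m b => exact h m b x
    | ha y z hy hz => rw [NTensor.add_tmul, map_add, map_add, hy, hz]

end

variable (M : Type u) [AddCommGroup M] [Module R M] [Module Rᵐᵒᵖ M] [SMulCommClass R Rᵐᵒᵖ M]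

/-- `M^{⊗0} ⊗_R X ≅ X`. -/
def tensFZeroIso : tensF R R (TPow R M 0) ≅ 𝟭 (ModuleCat.{u} R) :=
  NatIso.ofComponents (fun X => (NTensor.lid X).toModuleIso)
    fun f => ModuleCat.hom_ext (NTensor.linearHom_ext R (TPow R M 0) fun (r : R) x =>
      (map_smul f.hom r x).symm)

/-- `M^{⊗(i+1)} ⊗_R X ≅ M ⊗_R (M^{⊗i} ⊗_R X)`, as modules. -/
def tensSuccEquiv (i : ℕ) (X : Type u) [AddCommGroup X] [Module R X] :
    NTensor R (TPow R M (i + 1)) X ≃ₗ[R] NTensor R M (NTensor R (TPow R M i) X) :=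
  { NTensor.assoc X M (TPow R M i) with
    map_smul' := fun r z => by
      let : Module Rᵐᵒᵖ (NTensor R M (TPow R M i)) := NTensor.rightModule R
      have := NTensor.assoc_addHom_ext X M (TPow R M i)
        (f := (NTensor.assoc X M (TPow R M i)).toAddMonoidHom.comp
          (DistribSMul.toAddMonoidHom (NTensor R (TPow R M (i + 1)) X) r))
        (g := (DistribSMul.toAddMonoidHom (NTensor R M (NTensor R (TPow R M i) X)) r).comp
          (NTensor.assoc X M (TPow R M i)).toAddMonoidHom) fun _ _ _ => rfl
      exact DFunLike.congr_fun this z }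

/-- `M^{⊗(i+1)} ⊗_R X ≅ M ⊗_R (M^{⊗i} ⊗_R X)`. -/
def tensFSuccIso (i : ℕ) :
    tensF R R (TPow R M (i + 1)) ≅ tensF R R (TPow R M i) ⋙ tensF R R M :=
  NatIso.ofComponents (fun X => (tensSuccEquiv M i X).toModuleIso) fun {X Y} f => by
    refine ModuleCat.hom_ext (LinearMap.toAddMonoidHom_injective ?_)
    exact NTensor.assoc_addHom_ext X M (TPow R M i) fun _ _ _ => rfl

end TensorFunctor

/-! ### The functors `Hom(M^{⊗i}, -)` on right modules -/

section HomFunctor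

variable {R : Type u} [Ring R] (A : Type u) [AddCommGroup A] [Module R A] [Module Rᵐᵒᵖ A]
  [SMulCommClass R Rᵐᵒᵖ A]

/-- An element of `Hom_{Rᵒᵖ}(A, Y)`, as a linear map. -/
def homObjEquiv (Y : ModuleCat.{u} Rᵐᵒᵖ) : homObj A Y ≃+ (A →ₗ[Rᵐᵒᵖ] Y) := AddEquiv.refl _

variable {A} in
theorem homObj_ext {Y : ModuleCat.{u} Rᵐᵒᵖ} {f g : homObj A Y}
    (h : ∀ a, homObjEquiv A Y f a = homObjEquiv A Y g a) : f = g :=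
  (homObjEquiv A Y).injective (LinearMap.ext h)

/-- The map `Hom_{Rᵒᵖ}(A, X) → Hom_{Rᵒᵖ}(A, Y)` induced by `f : X → Y`. -/
def homObjMap {X Y : ModuleCat.{u} Rᵐᵒᵖ} (f : X ⟶ Y) : homObj A X →ₗ[Rᵐᵒᵖ] homObj A Y where
  toFun g := (homObjEquiv A Y).symm (f.hom.comp (homObjEquiv A X g))
  map_add' _ _ := homObj_ext fun _ => map_add f.hom _ _
  map_smul' _ _ := rfl

variable (R) in
/-- The functor `Hom_{Rᵒᵖ}(A, -)` on right `R`-modules. -/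
def homF : ModuleCat.{u} Rᵐᵒᵖ ⥤ ModuleCat.{u} Rᵐᵒᵖ where
  obj Y := homObj A Y
  map {X Y} f := ModuleCat.ofHom (X := homObj A X) (Y := homObj A Y) (homObjMap A f)

instance : (homF R A).Additive where
  map_add := rfl

/-- `Hom_{Rᵒᵖ}(A, -)` preserves a short exact sequence `0 → X₁ → X₂ → X₃ → 0` if
`Ext^1(A, X₁) = 0`. -/
theorem homF_shortExact {C : ShortComplex (ModuleCat.{u} Rᵐᵒᵖ)} (hC : C.ShortExact)
    (h : ExtVanishes 1 (ModuleCat.of Rᵐᵒᵖ A) C.X₁) : (C.map (homF R A)).ShortExact := by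
  have hex := (ShortComplex.ShortExact.moduleCat_exact_iff_function_exact _).1 hC.exact
  refine ModuleCat.shortComplex_shortExact _ (fun φ => ⟨fun hφ => ?_, ?_⟩) (fun φ ψ hφ => ?_)
    (fun φ => ?_)
  · have := hC.mono_f
    have h0 : ModuleCat.ofHom (X := A) (Y := C.X₂) (homObjEquiv A C.X₂ φ) ≫ C.g = 0 :=
      ModuleCat.hom_ext hφ
    exact ⟨(hC.exact.lift _ h0).hom, congrArg ModuleCat.Hom.hom (hC.exact.lift_f _ h0)⟩
  · rintro ⟨ψ, rfl⟩
    exact homObj_ext fun a => hex.apply_apply_eq_zero _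
  · exact homObj_ext fun a => hC.moduleCat_injective_f (LinearMap.congr_fun hφ a)
  · obtain ⟨ψ, hψ⟩ := ExtVanishes.exists_lift hC h (ModuleCat.ofHom (homObjEquiv A C.X₃ φ))
    exact ⟨ψ.hom, congrArg ModuleCat.Hom.hom hψ⟩

/-- `Hom_{Rᵒᵖ}(A, X^∨) ≃ (A ⊗_R X)^∨`. -/
def homRDualEquiv (X : ModuleCat.{u} R) :
    homObj A (rDual X) ≃ₗ[Rᵐᵒᵖ] rDual (tensorObj R A X) where
  toFun f := charTensorEquiv (homDualEquiv.symm (homObjEquiv A (rDual X) f))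
  invFun χ := (homObjEquiv A (rDual X)).symm (homDualEquiv (charTensorEquiv.symm χ))
  map_add' _ _ := NTensor.addHom_ext fun _ _ => rfl
  map_smul' _ _ := NTensor.addHom_ext fun _ _ => rfl
  left_inv _ := rfl
  right_inv _ := NTensor.addHom_ext fun _ _ => rfl

/-- `Hom_{Rᵒᵖ}(A, X^∨) ≅ (A ⊗_R X)^∨`. -/
def homRDualIso (X : ModuleCat.{u} R) : homObj A (rDual X) ≅ rDual (tensorObj R A X) :=
  (homRDualEquiv A X).toModuleIso

variable (M : Type u) [AddCommGroup M] [Module R M] [Module Rᵐᵒᵖ M] [SMulCommClass R Rᵐᵒᵖ M]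

/-- `Hom_{Rᵒᵖ}(M^{⊗0}, Y) ≃ Y`. -/
def homObjZeroEquiv (Y : ModuleCat.{u} Rᵐᵒᵖ) : homObj (TPow R M 0) Y ≃ₗ[Rᵐᵒᵖ] Y where
  toFun f := homObjEquiv (TPow R M 0) Y f (1 : R)
  invFun y := (homObjEquiv (TPow R M 0) Y).symm (show R →ₗ[Rᵐᵒᵖ] Y from
    { toFun := fun r : R => op r • y
      map_add' := fun r s => add_smul (op r) (op s) y
      map_smul' := fun r s => mul_smul r (op s) y })
  map_add' f g := rfl
  map_smul' r f := by
    refine Eq.trans ?_ (map_smul (homObjEquiv (TPow R M 0) Y f) r (1 : R))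
    exact congrArg (homObjEquiv (TPow R M 0) Y f) ((mul_one r.unop).trans (one_mul r.unop).symm)
  left_inv f := homObj_ext fun (r : R) => by
    refine (map_smul (homObjEquiv (TPow R M 0) Y f) (op r) (1 : R)).symm.trans ?_
    exact congrArg (homObjEquiv (TPow R M 0) Y f) (one_mul (M := R) r)
  right_inv y := one_smul Rᵐᵒᵖ y

/-- `Hom_{Rᵒᵖ}(M^{⊗0}, Y) ≅ Y`. -/
def homFZeroIso : homF R (TPow R M 0) ≅ 𝟭 (ModuleCat.{u} Rᵐᵒᵖ) :=
  NatIso.ofComponents (fun Y => (homObjZeroEquiv M Y).toModuleIso) fun _ => rfl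

/-- The homomorphism `M^{⊗(i+1)} → Y` with `m ⊗ x ↦ g(m)(x)`. -/
def homObjUncurry (i : ℕ) (Y : ModuleCat.{u} Rᵐᵒᵖ) (g : M →ₗ[Rᵐᵒᵖ] homObj (TPow R M i) Y) :
    TPow R M (i + 1) →+ Y :=
  NTensor.lift (R := R) (A := M) (X := TPow R M i)
    (AddMonoidHom.mk' (fun m => (homObjEquiv (TPow R M i) Y (g m)).toAddMonoidHom)
      fun m n => by rw [map_add, map_add]; rfl)
    fun m r x => LinearMap.congr_fun
      (congrArg (homObjEquiv (TPow R M i) Y) (map_smul g (op r) m)) x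

theorem homObjUncurry_smul (i : ℕ) (Y : ModuleCat.{u} Rᵐᵒᵖ)
    (g : M →ₗ[Rᵐᵒᵖ] homObj (TPow R M i) Y) (r : Rᵐᵒᵖ) (z : TPow R M (i + 1)) :
    homObjUncurry M i Y g (r • z) = r • homObjUncurry M i Y g z := by
  induction z using TensorRing.cons_induction with
  | h0 => rw [smul_zero, map_zero, smul_zero]
  | ht m x => exact map_smul (homObjEquiv (TPow R M i) Y (g m)) r x
  | ha y z hy hz => rw [smul_add, map_add, hy, hz, map_add, smul_add]

/-- The homomorphism `m ↦ (x ↦ f(m ⊗ x))`. -/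
def homObjCurry (i : ℕ) (Y : ModuleCat.{u} Rᵐᵒᵖ) (f : TPow R M (i + 1) →ₗ[Rᵐᵒᵖ] Y) :
    M →ₗ[Rᵐᵒᵖ] homObj (TPow R M i) Y where
  toFun m := (homObjEquiv (TPow R M i) Y).symm
    { toFun := fun x => f (TensorRing.cons i m x)
      map_add' := fun x y => (congrArg f (NTensor.tmul_add m x y)).trans (map_add f _ _)
      map_smul' := fun r x => map_smul f r (TensorRing.cons i m x) }
  map_add' m n := homObj_ext fun x =>
    (congrArg f (NTensor.add_tmul m n x)).trans (map_add f _ _)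
  map_smul' r m := homObj_ext fun x => congrArg f (TensorRing.cons_smul r.unop i m x)

theorem homObjUncurry_curry (i : ℕ) (Y : ModuleCat.{u} Rᵐᵒᵖ) (f : TPow R M (i + 1) →ₗ[Rᵐᵒᵖ] Y)
    (z : TPow R M (i + 1)) : homObjUncurry M i Y (homObjCurry M i Y f) z = f z := by
  induction z using TensorRing.cons_induction with
  | h0 => rw [map_zero, map_zero]
  | ht m x => rfl
  | ha y z hy hz => rw [map_add, map_add, hy, hz]

/-- `Hom_{Rᵒᵖ}(M^{⊗(i+1)}, Y) ≃ Hom_{Rᵒᵖ}(M, Hom_{Rᵒᵖ}(M^{⊗i}, Y))`. -/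
def homObjSuccEquiv (i : ℕ) (Y : ModuleCat.{u} Rᵐᵒᵖ) :
    homObj (TPow R M (i + 1)) Y ≃ₗ[Rᵐᵒᵖ] homObj M (homObj (TPow R M i) Y) where
  toFun f := (homObjEquiv M (homObj (TPow R M i) Y)).symm
    (homObjCurry M i Y (homObjEquiv (TPow R M (i + 1)) Y f))
  invFun g := (homObjEquiv (TPow R M (i + 1)) Y).symm
    { homObjUncurry M i Y (homObjEquiv M (homObj (TPow R M i) Y) g) with
      map_smul' := homObjUncurry_smul M i Y _ }
  map_add' _ _ := rfl
  map_smul' _ _ := rfl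
  left_inv _ := homObj_ext (homObjUncurry_curry M i Y _)
  right_inv _ := rfl

/-- `Hom_{Rᵒᵖ}(M^{⊗(i+1)}, Y) ≅ Hom_{Rᵒᵖ}(M, Hom_{Rᵒᵖ}(M^{⊗i}, Y))`. -/
def homFSuccIso (i : ℕ) : homF R (TPow R M (i + 1)) ≅ homF R (TPow R M i) ⋙ homF R M :=
  NatIso.ofComponents (fun Y => (homObjSuccEquiv M i Y).toModuleIso) fun _ => rfl

end HomFunctor

/-! ### Coproduct decompositions of free modules and of the tensor ring -/

section Coproducts

/-- `A ⊗_R R^{(J)}` is a coproduct of copies of `A`. -/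
theorem isCoprod_tensor_free (R S A : Type u) [Ring R] [Ring S] [AddCommGroup A] [Module S A]
    [Module Rᵐᵒᵖ A] [SMulCommClass S Rᵐᵒᵖ A] (J : Type u) :
    IsCoprod (fun j : J => ModuleCat.ofHom (X := A)
      (Y := tensorObj S A (ModuleCat.of R (J →₀ R)))
      ({ toFun := fun a => NTensor.tmul R a (Finsupp.single j (1 : R))
         map_add' := fun a b => NTensor.add_tmul a b _
         map_smul' := fun _ _ => rfl } : A →ₗ[S] NTensor R A (J →₀ R))) := by
  intro Y φ
  -- Coefficients can be moved into `A`, so maps out are determined by their values on `a ⊗ e_j`;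
  -- this gives uniqueness.
  have h1 : ∀ (j : J) (a : A) (r : R), NTensor.tmul R a (Finsupp.single j r) =
      NTensor.tmul R (op r • a) (Finsupp.single j (1 : R)) := fun j a r => by
    rw [NTensor.smul_tmul, Finsupp.smul_single, smul_eq_mul, mul_one]
  let F : A →+ (J →₀ R) →+ Y := AddMonoidHom.mk' (fun a => Finsupp.liftAddHom fun j =>
      (φ j).hom.toAddMonoidHom.comp (AddMonoidHom.mk' (fun r : R => op r • a)
        fun r s => add_smul (op r) (op s) a))
    fun a b => by
      refine Finsupp.addHom_ext fun j r => ?_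
      simp
  have hF : ∀ a j r, F a (Finsupp.single j r) = (φ j).hom (op r • a) := fun a j r =>
    Finsupp.liftAddHom_apply_single _ _ _
  let Φ : NTensor R A (J →₀ R) →+ Y := NTensor.lift F fun a r x => by
    induction x using Finsupp.induction_linear with
    | zero => simp
    | add x y hx hy => rw [smul_add, map_add, map_add, hx, hy]
    | single j s => rw [Finsupp.smul_single, hF, hF, smul_smul]; rfl
  have hΦ : ∀ a j r, Φ (NTensor.tmul R a (Finsupp.single j r)) = (φ j).hom (op r • a) := hF
  refine ⟨ModuleCat.ofHom { Φ with map_smul' := fun s z => ?_ }, fun j => ?_, fun Ψ hΨ => ?_⟩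
  · change Φ (s • z) = s • Φ z
    induction z using NTensor.induction_on with
    | h0 => simp
    | ht a x =>
      induction x using Finsupp.induction_linear with
      | zero => simp [NTensor.tmul_zero]
      | add x y hx hy => rw [NTensor.tmul_add, smul_add, map_add, map_add, hx, hy, smul_add]
      | single j r => rw [NTensor.smul_tmul', hΦ, hΦ, ← smul_comm, map_smul]
    | ha y z hy hz => rw [smul_add, map_add, map_add, hy, hz, smul_add]
  · ext a
    exact (hΦ a j 1).trans (by rw [op_one, one_smul])
  · refine ModuleCat.hom_ext (NTensor.linearHom_ext S A fun a x => ?_)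
    change Ψ.hom (NTensor.tmul R a x) = Φ (NTensor.tmul R a x)
    induction x using Finsupp.induction_linear with
    | zero => rw [NTensor.tmul_zero, map_zero, map_zero]
    | add x y hx hy => rw [NTensor.tmul_add, map_add, map_add, hx, hy]
    | single j r =>
      rw [h1, hΦ, op_one, one_smul]
      exact congrArg (fun t => t.hom (op r • a)) (hΨ j)

/-- For free `P` the tensor product is a coproduct of copies of `A`; a projective is a retract of a
free module. -/
theorem ExtVanishes.tensor_projective {R S A : Type u} [Ring R] [Ring S] [AddCommGroup A]
    [Module S A] [Module Rᵐᵒᵖ A] [SMulCommClass S Rᵐᵒᵖ A] {n : ℕ} {W : ModuleCat.{u} S}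
    (h : ExtVanishes (n + 1) (ModuleCat.of S A) W) (P : ModuleCat.{u} R) [Projective P] :
    ExtVanishes (n + 1) (tensorObj S A P) W := by
  obtain ⟨J, ⟨r⟩⟩ := exists_retract_free P
  exact ((isCoprod_tensor_free R S A J).extVanishes fun _ => h).of_retract_left
    (r.map (tensF R S A))

/-- The restriction of a free `S`-module is a coproduct of copies of the restriction of `S`. -/
theorem isCoprod_restrict_free {R S : Type u} [Ring R] [Ring S] (f : R →+* S) (J : Type u) :
    IsCoprod (fun j : J => (ModuleCat.restrictScalars f).map
      (ModuleCat.ofHom (Finsupp.lsingle j : S →ₗ[S] J →₀ S))) := by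
  intro Y φ
  let Φ : (J →₀ S) →+ Y := Finsupp.liftAddHom fun j => (φ j).hom.toAddMonoidHom
  have hΦ : ∀ j s, Φ (Finsupp.single j s) = (φ j).hom s := fun j s =>
    Finsupp.liftAddHom_apply_single _ _ _
  have hs : ∀ (r : R) (x : J →₀ S), Φ (f r • x) = r • Φ x := fun r x => by
    induction x using Finsupp.induction_linear with
    | zero => simp
    | add x y hx hy => rw [smul_add, map_add, map_add, hx, hy, smul_add]
    | single j s =>
      rw [Finsupp.smul_single, hΦ, hΦ]
      exact map_smul (φ j).hom r (show (ModuleCat.restrictScalars f).obj (ModuleCat.of S S) from s)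
  refine ⟨ModuleCat.ofHom (X := (ModuleCat.restrictScalars f).obj (ModuleCat.of S (J →₀ S)))
    { Φ with map_smul' := hs }, fun j => ?_, fun Ψ hΨ => ?_⟩
  · ext s
    exact hΦ j s
  · refine ModuleCat.hom_ext (LinearMap.toAddMonoidHom_injective ?_)
    exact Finsupp.addHom_ext fun j s =>
      (congrArg (fun t => t.hom s) (hΨ j)).trans (hΦ j s).symm

namespace TensorRing

variable (R M : Type u) [Ring R] [AddCommGroup M] [Module R M] [Module Rᵐᵒᵖ M]
  [SMulCommClass R Rᵐᵒᵖ M]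

variable {R M} in
theorem incl_mul_of (r : R) (i : ℕ) (x : TPow R M i) : incl R M r * of R M i x = of R M i (r • x) :=
  (mulHom_of 0 _ _).trans ((actLin_zero r _).trans (smul_of r i x))

variable {R M} in
theorem of_mul_incl (r : R) (i : ℕ) (x : TPow R M i) :
    of R M i x * incl R M r = of R M i (op r • x) := by
  change mulHom R M (of R M i x) (incl R M r) = _
  rw [mulHom_of]
  induction i with
  | zero =>
    obtain ⟨s, rfl⟩ := (zeroEquiv R M).surjective x
    exact (actLin_zero s _).trans (smul_of s 0 _)
  | succ i ih =>
    induction x using cons_induction with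
    | h0 => simp
    | ht m x =>
      rw [actLin_cons, ih, shift_of]
      rfl
    | ha y z hy hz => rw [smul_add, map_add, map_add, AddMonoidHom.add_apply, hy, hz]

/-- As a left `R`-module, `T_R(M)` is the coproduct of the tensor powers of `M`. -/
theorem isCoprod_left :
    IsCoprod (fun i : ℕ => ModuleCat.ofHom (X := TPow R M i)
      (Y := (ModuleCat.restrictScalars (incl R M)).obj (ModuleCat.of (TensorRing R M)
        (TensorRing R M)))
      { toFun := of R M i
        map_add' := map_add _
        map_smul' := fun r x => (incl_mul_of r i x).symm }) := by
  intro Y φ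
  let Φ : TensorRing R M →+ Y := lift fun i => (φ i).hom.toAddMonoidHom
  have hΦ : ∀ i x, Φ (of R M i x) = (φ i).hom x := fun i x => lift_of _ i x
  have hs : ∀ (r : R) (t : TensorRing R M), Φ (incl R M r * t) = r • Φ t := fun r t =>
    DFunLike.congr_fun (addHom_ext (f := Φ.comp (AddMonoidHom.mulLeft (incl R M r)))
      (g := (DistribSMul.toAddMonoidHom Y r).comp Φ) fun i x => by
        change Φ (incl R M r * of R M i x) = r • Φ (of R M i x)
        rw [incl_mul_of, hΦ, hΦ, map_smul]) t
  refine ⟨ModuleCat.ofHom { Φ with map_smul' := hs }, fun i => ?_, fun Ψ hΨ => ?_⟩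
  · ext x
    exact hΦ i x
  · refine ModuleCat.hom_ext (LinearMap.toAddMonoidHom_injective ?_)
    exact addHom_ext fun i x => (congrArg (fun t => t.hom x) (hΨ i)).trans (hΦ i x).symm

/-- As a right `R`-module, `T_R(M)` is the coproduct of the tensor powers of `M`. -/
theorem isCoprod_right :
    IsCoprod (fun i : ℕ => ModuleCat.ofHom (X := TPow R M i) (Y := TensorRing R M)
      ({ toFun := of R M i
         map_add' := map_add _
         map_smul' := fun r x => (of_mul_incl r.unop i x).symm } :
          TPow R M i →ₗ[Rᵐᵒᵖ] TensorRing R M)) := by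
  intro Y φ
  let Φ : TensorRing R M →+ Y := lift fun i => (φ i).hom.toAddMonoidHom
  have hΦ : ∀ i x, Φ (of R M i x) = (φ i).hom x := fun i x => lift_of _ i x
  have hs : ∀ (r : Rᵐᵒᵖ) (t : TensorRing R M), Φ (t * incl R M r.unop) = r • Φ t := fun r t =>
    DFunLike.congr_fun (addHom_ext (f := Φ.comp (AddMonoidHom.mulRight (incl R M r.unop)))
      (g := (DistribSMul.toAddMonoidHom Y r).comp Φ) fun i x => by
        change Φ (of R M i x * incl R M r.unop) = r • Φ (of R M i x)
        rw [of_mul_incl, hΦ, hΦ, op_unop, map_smul]) t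
  refine ⟨ModuleCat.ofHom { Φ with map_smul' := hs }, fun i => ?_, fun Ψ hΨ => ?_⟩
  · ext x
    exact hΦ i x
  · refine ModuleCat.hom_ext (LinearMap.toAddMonoidHom_injective ?_)
    exact addHom_ext fun i x => (congrArg (fun t => t.hom x) (hΨ i)).trans (hΦ i x).symm

end TensorRing

end Coproducts

/-! ### Change of rings and projective terms -/

section General

variable {R S : Type u} [Ring R] [Ring S]

theorem acyclic_restrictScalars (f : R →+* S) {Q : CochainComplex (ModuleCat.{u} S) ℤ}
    (hQ : Q.Acyclic) :
    (((ModuleCat.restrictScalars f).mapHomologicalComplex _).obj Q).Acyclic := fun j => by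
  have h := hQ j
  rw [HomologicalComplex.exactAt_iff' _ (j - 1) j (j + 1) (by simp) (by simp)] at h ⊢
  have hex := (ShortComplex.ShortExact.moduleCat_exact_iff_function_exact _).1 h
  exact (ShortComplex.ShortExact.moduleCat_exact_iff_function_exact _).2 hex

/-- Dimension shifting to the right from position `j`. The sequences are arbitrary rather than
`kerDSeq` itself, so that the lemma also applies after tensoring the cycle sequences. -/
theorem extVanishes_kerD_left {W : ModuleCat.{u} R} {T : ℤ → ShortComplex (ModuleCat.{u} R)} {Z : ℤ → ModuleCat.{u} R} {d : ℕ}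
    (hT : ∀ j, (T j).ShortExact) (e₁ : ∀ j, (T j).X₁ ≅ Z j) (e₃ : ∀ j, (T j).X₃ ≅ Z (j + 1))
    (hE : ∀ j n, ExtVanishes (n + 1) (T j).X₂ W) [HasInjectiveDimensionLT W d] (j : ℤ) (n : ℕ) :
    ExtVanishes (n + 1) (Z j) W := by
  have := extVanishes_of_coresolution (W := W) (d := d) (Z := fun k : ℕ => Z (j + k))
    (S := fun k : ℕ => T (j + k)) (fun k => hT _) (fun k => e₁ _)
    (fun k => e₃ _ ≪≫ eqToIso (by push_cast; rw [add_assoc])) (fun k n => hE _ _) 0 n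
  simpa using this

theorem tensor_projective_projective (S A : Type u) [Ring S] [AddCommGroup A] [Module S A]
    [Module Rᵐᵒᵖ A] [SMulCommClass S Rᵐᵒᵖ A] (hA : Projective (ModuleCat.of S A))
    (P : ModuleCat.{u} R) [Projective P] : Projective (tensorObj S A P) :=
  projective_iff_subsingleton_ext_one.2 fun _ => ExtVanishes.tensor_projective .of_projective P

theorem hasProjectiveDimensionLE_tensor_projective {A : Type u} [AddCommGroup A] [Module S A]
    [Module Rᵐᵒᵖ A] [SMulCommClass S Rᵐᵒᵖ A] {d : ℕ}
    (hA : HasProjectiveDimensionLE (ModuleCat.of S A) d) (P : ModuleCat.{u} R) [Projective P] :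
    HasProjectiveDimensionLE (tensorObj S A P) d :=
  (hasProjectiveDimensionLT_iff_extVanishes _ _).2 fun Y =>
    ExtVanishes.tensor_projective ((hasProjectiveDimensionLT_iff_extVanishes _ _).1 hA Y) P

/-- `A` is a retract of `A ⊗ R^{(J)}`: include one summand, then sum up. -/
theorem ExtVanishes.of_tensor_free {A : Type u} [AddCommGroup A] [Module S A]
    [Module Rᵐᵒᵖ A] [SMulCommClass S Rᵐᵒᵖ A] {n : ℕ} {W : ModuleCat.{u} S} {J : Type u} [Nonempty J]
    (h : ExtVanishes n (tensorObj S A (ModuleCat.of R (J →₀ R))) W) :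
    ExtVanishes n (ModuleCat.of S A) W := by
  obtain ⟨Φ, hΦ, -⟩ := isCoprod_tensor_free R S A J (ModuleCat.of S A) fun _ => 𝟙 _
  exact h.of_retract_left ⟨_, Φ, hΦ (Classical.arbitrary J)⟩

theorem extVanishes_restrict_projective (f : R →+* S) {n : ℕ} {W : ModuleCat.{u} R}
    (h : ExtVanishes (n + 1) ((ModuleCat.restrictScalars f).obj (ModuleCat.of S S)) W)
    (P : ModuleCat.{u} S) [Projective P] :
    ExtVanishes (n + 1) ((ModuleCat.restrictScalars f).obj P) W := by
  obtain ⟨J, ⟨r⟩⟩ := exists_retract_free P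
  exact ((isCoprod_restrict_free f J).extVanishes fun _ => h).of_retract_left
    (r.map (ModuleCat.restrictScalars f))

theorem acyclic_tensor_iff (A : Type u) [AddCommGroup A] [Module Rᵐᵒᵖ A]
    (Q : CochainComplex (ModuleCat.{u} R) ℤ) (h : HomIntoExact Q (ModuleCat.of R (LDual R A))) :
    (((tensorFunctor R A).mapHomologicalComplex _).obj Q).Acyclic := fun j => by
  rw [HomologicalComplex.exactAt_iff' _ (j - 1) j (j + 1) (by simp) (by simp),
    ShortComplex.ab_exact_iff_function_exact]
  refine (tensor_exact_iff (A := A) (Q.d (j - 1) j).hom (Q.d j (j + 1)).hom ?_).2 fun φ hφ => ?_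
  · rw [← ModuleCat.hom_comp, Q.d_comp_d]; rfl
  · obtain ⟨g, hg⟩ := h j (ModuleCat.ofHom φ) (ModuleCat.hom_ext hφ)
    exact ⟨g.hom, congrArg ModuleCat.Hom.hom hg⟩

end General

/-! ### Compatibility and admissibility -/

section Left

variable (R M : Type u) [Ring R] [AddCommGroup M] [Module R M] [Module Rᵐᵒᵖ M]
  [SMulCommClass R Rᵐᵒᵖ M]

/-- `Tor_n(M, M^{⊗i} ⊗_R X) = 0` for all `n ≥ 1` and `i ≥ 0`. -/
def TorAcyclic (X : ModuleCat.{u} R) : Prop :=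
  ∀ i n : ℕ, ExtVanishes (n + 1) ((tensF R R (TPow R M i)).obj X) (ModuleCat.of R (LDual R M))

variable {R M}

theorem TorAcyclic.of_iso {X Y : ModuleCat.{u} R} (e : X ≅ Y) (h : TorAcyclic R M Y) :
    TorAcyclic R M X :=
  fun i n => (h i n).of_iso_left ((tensF R R (TPow R M i)).mapIso e)

theorem ConditionT.torAcyclic (hT : ConditionT R M) (P : ModuleCat.{u} R) [Projective P] :
    TorAcyclic R M P
  -- Condition (T) starts at `i = 1`; for `i = 0` the module is `P` itself.
  | 0, _ => ExtVanishes.of_iso_left ((tensFZeroIso M).app P) (.of_projective (X := P))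
  | i + 1, n => (torVanishes_iff M n _).1 (hT P inferInstance (i + 1) (by omega) (n + 1) (by omega))

theorem tensF_zero_shortExact {S : ShortComplex (ModuleCat.{u} R)} (hS : S.ShortExact) :
    (S.map (tensF R R (TPow R M 0))).ShortExact :=
  ShortComplex.shortExact_of_iso (S.mapNatIso (tensFZeroIso M)).symm hS

theorem tensF_succ_shortExact {S : ShortComplex (ModuleCat.{u} R)} {i : ℕ}
    (hS : (S.map (tensF R R (TPow R M i))).ShortExact)
    (h : ExtVanishes 1 ((tensF R R (TPow R M i)).obj S.X₃) (ModuleCat.of R (LDual R M))) :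
    (S.map (tensF R R (TPow R M (i + 1)))).ShortExact :=
  ShortComplex.shortExact_of_iso (S.mapNatIso (tensFSuccIso M i)).symm (tensF_shortExact R M hS h)

theorem TorAcyclic.shortExact {S : ShortComplex (ModuleCat.{u} R)} (hS : S.ShortExact)
    (h : TorAcyclic R M S.X₃) (i : ℕ) : (S.map (tensF R R (TPow R M i))).ShortExact := by
  induction i with
  | zero => exact tensF_zero_shortExact hS
  | succ i ih => exact tensF_succ_shortExact ih (h i 0)

theorem TorAcyclic.X₁ {S : ShortComplex (ModuleCat.{u} R)} (hS : S.ShortExact)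
    (h₂ : TorAcyclic R M S.X₂) (h₃ : TorAcyclic R M S.X₃) : TorAcyclic R M S.X₁ := fun i n =>
  ExtVanishes.left_X₁ (h₃.shortExact hS i) (h₂ i n) (h₃ i (n + 1))

variable (M) in
-- The powers are built by adding factors on the left, so absorbing a factor on the right takes an
-- induction. It makes Tor-acyclicity stable under `M ⊗ -`.
theorem tensF_comm (i : ℕ) (X : ModuleCat.{u} R) :
    Nonempty ((tensF R R (TPow R M i)).obj ((tensF R R M).obj X) ≅
      (tensF R R (TPow R M (i + 1))).obj X) := by
  induction i with
  | zero => exact ⟨(tensFZeroIso M).app ((tensF R R M).obj X) ≪≫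
      ((tensF R R M).mapIso ((tensFZeroIso M).app X)).symm ≪≫ ((tensFSuccIso M 0).app X).symm⟩
  | succ i ih =>
    obtain ⟨e⟩ := ih
    exact ⟨(tensFSuccIso M i).app ((tensF R R M).obj X) ≪≫ (tensF R R M).mapIso e ≪≫
      ((tensFSuccIso M (i + 1)).app X).symm⟩

theorem TorAcyclic.tens {X : ModuleCat.{u} R} (h : TorAcyclic R M X) :
    TorAcyclic R M ((tensF R R M).obj X) := fun i n => by
  obtain ⟨e⟩ := tensF_comm M i X
  exact (h (i + 1) n).of_iso_left e

theorem TorAcyclic.tensPow {X : ModuleCat.{u} R} (h : TorAcyclic R M X) (i : ℕ) :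
    TorAcyclic R M ((tensF R R (TPow R M i)).obj X) := by
  induction i with
  | zero => exact h.of_iso ((tensFZeroIso M).app X)
  | succ i ih => exact ih.tens.of_iso ((tensFSuccIso M i).app X)

/-- Projectives go to modules of projective dimension at most `d`, and `M ⊗ -` keeps exact the short
exact sequences of a projective resolution of a Tor-acyclic module. -/
theorem TorAcyclic.tens_finite (hT : ConditionT R M) {d : ℕ}
    (hd : HasProjectiveDimensionLE (ModuleCat.of R M) d) {X : ModuleCat.{u} R}
    (h : TorAcyclic R M X) {n : ℕ} (hn : HasProjectiveDimensionLE X n) :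
    ∃ m, HasProjectiveDimensionLE ((tensF R R M).obj X) m := by
  refine projectiveDimension_induction (C := TorAcyclic R M)
    (p := fun X => ∃ m, HasProjectiveDimensionLE ((tensF R R M).obj X) m)
    (fun S hS hP h₃ => TorAcyclic.X₁ hS (hT.torAcyclic _) h₃)
    (fun P hP => ⟨d, hasProjectiveDimensionLE_tensor_projective hd P⟩) ?_ h n hn
  rintro S hS hP h₃ ⟨m₁, h₁⟩ ⟨m₂, h₂⟩
  have h0 : ExtVanishes 1 S.X₃ (ModuleCat.of R (LDual R M)) :=
    (h₃ 0 0).of_iso_left ((tensFZeroIso M).app S.X₃).symm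
  have h₁' : HasProjectiveDimensionLT (S.map (tensF R R M)).X₁ (m₁ + 1) := h₁
  have h₂' : HasProjectiveDimensionLT (S.map (tensF R R M)).X₂ (m₂ + 1) := h₂
  -- The bound is `pd X₃ ≤ max (pd X₁ + 1) (pd X₂)`.
  exact ⟨max (m₁ + 1) m₂, (tensF_shortExact R M hS h0).hasProjectiveDimensionLT_X₃ _
    (hasProjectiveDimensionLT_of_ge _ (m₁ + 1) _ (by omega))
    (hasProjectiveDimensionLT_of_ge _ (m₂ + 1) _ (by omega))⟩

theorem tensPow_projective_finite (hT : ConditionT R M) {d : ℕ}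
    (hd : HasProjectiveDimensionLE (ModuleCat.of R M) d) (P : ModuleCat.{u} R) [Projective P]
    (i : ℕ) : ∃ m, HasProjectiveDimensionLE ((tensF R R (TPow R M i)).obj P) m := by
  induction i with
  | zero => exact ⟨0, hasProjectiveDimensionLT_of_iso ((tensFZeroIso M).app P).symm 1⟩
  | succ i ih =>
    obtain ⟨m, hm⟩ := ih
    obtain ⟨k, hk⟩ := TorAcyclic.tens_finite hT hd ((hT.torAcyclic P).tensPow i) hm
    have hk' : HasProjectiveDimensionLT
      ((tensF R R (TPow R M i) ⋙ tensF R R M).obj P) (k + 1) := hk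
    exact ⟨k, hasProjectiveDimensionLT_of_iso ((tensFSuccIso M i).app P).symm (k + 1)⟩

/-- This is `Tor_1(M^{⊗i}, X) = 0`, whereas Tor-acyclicity concerns `Tor(M, M^{⊗i} ⊗ X)`. It follows
because `M^{⊗i} ⊗ -` keeps a projective presentation of `X` exact. -/
theorem TorAcyclic.extVanishes_lDual_tpow {X : ModuleCat.{u} R} (h : TorAcyclic R M X) (i : ℕ) :
    ExtVanishes 1 X (ModuleCat.of R (LDual R (TPow R M i))) := by
  obtain ⟨S, hS, hP, rfl⟩ := exists_projective_shortExact X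
  refine ExtVanishes.one_of_extension hS .of_projective fun φ => ?_
  obtain ⟨χ, hχ⟩ := exists_char_extension
    (NTensor.map (LinearMap.id (M := TPow R M i)) S.f.hom)
    (h.shortExact hS i).moduleCat_injective_f (charTensorEquiv φ.hom)
  refine ⟨ModuleCat.ofHom (charTensorEquiv.symm χ), ?_⟩
  ext x
  exact LDual.ext (R := R) fun a => hχ (NTensor.tmul R a x)

theorem TorAcyclic.ind_shortExact {S : ShortComplex (ModuleCat.{u} R)} (hS : S.ShortExact)
    (h : TorAcyclic R M S.X₃) :
    (S.map (tensF R (TensorRing R M) (TensorRing R M))).ShortExact :=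
  -- Balance puts the tensor ring in the first variable of `Ext`, where its decomposition into
  -- tensor powers can be used; a second use of balance returns each summand to `Tor_1(M^{⊗i}, X₃)`.
  tensF_shortExact _ _ hS <| (extVanishes_lDual_iff 0 S.X₃
    (ModuleCat.of Rᵐᵒᵖ (TensorRing R M))).2 <| (TensorRing.isCoprod_right R M).extVanishes fun i =>
      (extVanishes_lDual_iff 0 S.X₃ (ModuleCat.of Rᵐᵒᵖ (TPow R M i))).1
        (h.extVanishes_lDual_tpow i)

/-- Induction carries a finite projective resolution of `X` over `R` to one over the tensor ring,
and Hom-exactness passes along its short exact pieces. -/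
theorem TorAcyclic.homIntoExact_ind (hT : ConditionT R M)
    {Q : CochainComplex (ModuleCat.{u} (TensorRing R M)) ℤ} (hQ : IsCompleteProjRes Q)
    {X : ModuleCat.{u} R} (h : TorAcyclic R M X) {n : ℕ} (hn : HasProjectiveDimensionLE X n) :
    HomIntoExact Q (Ind R M X) := by
  have hpr : Projective (ModuleCat.of (TensorRing R M) (TensorRing R M)) := inferInstance
  refine projectiveDimension_induction (C := TorAcyclic R M)
    (p := fun X => HomIntoExact Q (Ind R M X))
    (fun S hS hP h₃ => TorAcyclic.X₁ hS (hT.torAcyclic _) h₃)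
    (fun P hP => hQ.hom_exact _ (tensor_projective_projective _ _ hpr P))
    (fun S hS hP h₃ h₁ h₂ => ?_) h n hn
  exact HomIntoExact.of_shortExact hQ.projective (h₃.ind_shortExact hS) h₁ h₂

theorem ConditionT.extVanishes_restrict (hT : ConditionT R M)
    (P : ModuleCat.{u} (TensorRing R M)) [Projective P] (n : ℕ) :
    ExtVanishes (n + 1) ((ModuleCat.restrictScalars (TensorRing.incl R M)).obj P)
      (ModuleCat.of R (LDual R M)) := by
  refine extVanishes_restrict_projective _ ((TensorRing.isCoprod_left R M).extVanishes fun i => ?_) P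
  -- Condition (T) is applied to the free module of rank one, which recovers the summand `M^{⊗i}`.
  exact ExtVanishes.of_tensor_free (J := PUnit) (hT.torAcyclic _ i n)

theorem isCompatible_of_finite (hT : ConditionT R M) {d k : ℕ}
    (hd : HasProjectiveDimensionLE (ModuleCat.of R M) d)
    (hk : HasInjectiveDimensionLE (ModuleCat.of R (LDual R M)) k) : IsCompatible R M M := by
  intro Q hQ
  constructor
  · have hacyc : (restrictComplex R M Q).Acyclic := acyclic_restrictScalars _ hQ.exact
    refine acyclic_tensor_iff M _ (homIntoExact_of_extVanishes hacyc fun j => ?_)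
    refine extVanishes_kerD_left (kerDSeq_shortExact hacyc) (fun _ => Iso.refl _)
      (fun _ => Iso.refl _) (fun j n => ?_) (d := k + 1) j 0
    have := hQ.projective j
    exact hT.extVanishes_restrict (Q.X j) n
  · intro P hP
    obtain ⟨m, hm⟩ := (hT.torAcyclic P).tens_finite hT hd (n := 0)
      ((projective_iff_hasProjectiveDimensionLE_zero P).1 hP)
    exact (hT.torAcyclic P).tens.homIntoExact_ind hT hQ hm

/-- The cycles of an acyclic complex of projectives are `Tor`-acyclic if `M` has finite flat
dimension on the right. -/
theorem torAcyclic_kerD (hT : ConditionT R M) {k : ℕ}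
    (hk : HasInjectiveDimensionLE (ModuleCat.of R (LDual R M)) k)
    {Q : CochainComplex (ModuleCat.{u} R) ℤ} (hQ : Q.Acyclic) (hP : ∀ j, Projective (Q.X j))
    (j : ℤ) : TorAcyclic R M (kerD Q j) := by
  -- Exactness and vanishing are proved alternately: if `M^{⊗i} ⊗ -` keeps the cycle sequences
  -- exact, shifting along them gives `Tor(M, M^{⊗i} ⊗ ker d_j) = 0`, which in turn gives exactness
  -- for `i + 1`.
  have ext_of : ∀ i, (∀ j, ((kerDSeq Q j).map (tensF R R (TPow R M i))).ShortExact) → ∀ j n,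
      ExtVanishes (n + 1) ((tensF R R (TPow R M i)).obj (kerD Q j)) (ModuleCat.of R (LDual R M)) :=
    fun i h j n => extVanishes_kerD_left h
      (Z := fun j => (tensF R R (TPow R M i)).obj (kerD Q j)) (fun _ => Iso.refl _)
      (fun _ => Iso.refl _) (fun j n => have := hP j; hT.torAcyclic (Q.X j) i n) (d := k + 1) j n
  have key : ∀ i j, ((kerDSeq Q j).map (tensF R R (TPow R M i))).ShortExact := fun i => by
    induction i with
    | zero => exact fun j => tensF_zero_shortExact (kerDSeq_shortExact hQ j)
    | succ i ih => exact fun j => tensF_succ_shortExact (ih j) (ext_of i ih (j + 1) 0)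
  exact fun i n => ext_of i (key i) j n

theorem isAdmissible_of_finite (hT : ConditionT R M) {d k : ℕ}
    (hd : HasProjectiveDimensionLE (ModuleCat.of R M) d)
    (hk : HasInjectiveDimensionLE (ModuleCat.of R (LDual R M)) k) : IsAdmissible R M := by
  rintro G ⟨Q, hQ, ⟨e⟩⟩ P hP i
  have e' : G ≅ kerD Q 0 := e
  constructor
  · obtain ⟨m, hm⟩ := tensPow_projective_finite hT hd P i
    exact ((hQ.homIntoExact hm).extVanishes hQ.exact hQ.projective 0).of_iso_left e'
  · exact (torVanishes_iff M 0 _).2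
      (((torAcyclic_kerD hT hk hQ.exact hQ.projective 0).of_iso e') i 0)

end Left

/-! ### Coinduction, injective terms and shifting to the left -/

section General

variable {R S : Type u} [Ring R] [Ring S]

/-- `Ext` out of `W` shifts towards lower cohomological index, so the `k`-th sequence is the one at
`j - k - 1`, ending in `Z (j - k)`. -/
theorem extVanishes_kerD_right {W : ModuleCat.{u} R} {T : ℤ → ShortComplex (ModuleCat.{u} R)}
    {Z : ℤ → ModuleCat.{u} R} {d : ℕ} (hT : ∀ j, (T j).ShortExact) (e₁ : ∀ j, (T j).X₁ ≅ Z j)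
    (e₃ : ∀ j, (T j).X₃ ≅ Z (j + 1)) (hE : ∀ j n, ExtVanishes (n + 1) W (T j).X₂)
    [HasProjectiveDimensionLT W d] (j : ℤ) (n : ℕ) : ExtVanishes (n + 1) W (Z j) := by
  have := extVanishes_of_resolution (W := W) (d := d) (Z := fun k : ℕ => Z (j - k))
    (S := fun k : ℕ => T (j - k - 1)) (fun k => hT _)
    (fun k => e₁ _ ≪≫ eqToIso (by push_cast; rw [sub_sub]))
    (fun k => e₃ _ ≪≫ eqToIso (by rw [sub_add_cancel])) (fun k n => hE _ _) 0 n
  simpa using this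

/-- `E` is a retract of `F^∨` with `F` free, so `Hom(A, E)` is a retract of `(A ⊗ F)^∨`. By balance
this involves `Ext^{n+1}(A ⊗ F, Y^∨)`, which vanishes because `A ⊗ F` is a coproduct of copies of
`A`. -/
theorem hasInjectiveDimensionLE_homObj_injective {A : Type u} [AddCommGroup A] [Module R A]
    [Module Rᵐᵒᵖ A] [SMulCommClass R Rᵐᵒᵖ A] {n : ℕ}
    (hA : HasResolutionOfLength IsFlatLeft n (ModuleCat.of R A)) (E : ModuleCat.{u} Rᵐᵒᵖ)
    [Injective E] : HasInjectiveDimensionLE (homObj A E) n := by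
  obtain ⟨J, ⟨r⟩⟩ := exists_retract_rDual E
  refine (hasInjectiveDimensionLT_iff_extVanishes _ _).2 fun Y => ?_
  have h := (extVanishes_lDual_iff n _ Y).2 (extVanishes_rDual_of_resolution n _ hA Y (n + 1)
    (Nat.lt_succ_self n))
  exact (((extVanishes_lDual_iff n _ Y).1 (h.tensor_projective
    (ModuleCat.of R (J →₀ R)))).of_iso_right (homRDualIso A _)).of_retract_right (r.map (homF R A))

/-- Restriction of scalars commutes with character modules. -/
def restrictRDualIso (f : R →+* S) (Y : ModuleCat.{u} S) :
    (ModuleCat.restrictScalars f.op).obj (rDual Y) ≅ rDual ((ModuleCat.restrictScalars f).obj Y) :=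
  ({ toFun := fun χ => χ
     invFun := fun χ => χ
     left_inv := fun _ => rfl
     right_inv := fun _ => rfl
     map_add' := fun _ _ => rfl
     map_smul' := fun _ _ => rfl } : (ModuleCat.restrictScalars f.op).obj (rDual Y) ≃ₗ[Rᵐᵒᵖ]
      rDual ((ModuleCat.restrictScalars f).obj Y)).toModuleIso

instance (f : R →+* S) : (ModuleCat.coextendScalars.{u, u} f).Additive where
  map_add := rfl

/-- Coinduction preserves a short exact sequence `0 → X₁ → X₂ → X₃ → 0` if `Ext^1(S, X₁) = 0`. -/
theorem coextendScalars_shortExact (f : R →+* S) {C : ShortComplex (ModuleCat.{u} R)}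
    (hC : C.ShortExact)
    (h : ExtVanishes 1 ((ModuleCat.restrictScalars f).obj (ModuleCat.of S S)) C.X₁) :
    (C.map (ModuleCat.coextendScalars f)).ShortExact := by
  have hex := (ShortComplex.ShortExact.moduleCat_exact_iff_function_exact _).1 hC.exact
  refine ModuleCat.shortComplex_shortExact _ (fun φ => ⟨fun hφ => ?_, ?_⟩) (fun φ ψ hφ => ?_)
    (fun φ => ?_)
  · have := hC.mono_f
    have h0 : ModuleCat.ofHom (X := (ModuleCat.restrictScalars f).obj (ModuleCat.of S S))
      (Y := C.X₂) φ ≫ C.g = 0 := ModuleCat.hom_ext hφ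
    exact ⟨(hC.exact.lift _ h0).hom, congrArg ModuleCat.Hom.hom (hC.exact.lift_f _ h0)⟩
  · rintro ⟨ψ, rfl⟩
    exact LinearMap.ext fun a => hex.apply_apply_eq_zero _
  · exact LinearMap.ext fun a => hC.moduleCat_injective_f (LinearMap.congr_fun hφ a)
  · obtain ⟨ψ, hψ⟩ := ExtVanishes.exists_lift hC h (ModuleCat.ofHom
      (X := (ModuleCat.restrictScalars f).obj (ModuleCat.of S S)) (Y := C.X₃) φ)
    exact ⟨ψ.hom, congrArg ModuleCat.Hom.hom hψ⟩

instance (f : R →+* S) (E : ModuleCat.{u} R) [Injective E] :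
    Injective ((ModuleCat.coextendScalars f).obj E) :=
  Injective.injective_of_adjoint (ModuleCat.restrictCoextendScalarsAdj f) E

end General

/-! ### Co-compatibility and co-admissibility -/

section Right

variable (R M : Type u) [Ring R] [AddCommGroup M] [Module R M] [Module Rᵐᵒᵖ M]
  [SMulCommClass R Rᵐᵒᵖ M]

/-- `Ext^n(M, Hom(M^{⊗i}, Y)) = 0` for all `n ≥ 1` and `i ≥ 0`. -/
def HomAcyclic (Y : ModuleCat.{u} Rᵐᵒᵖ) : Prop :=
  ∀ i n : ℕ, ExtVanishes (n + 1) (ModuleCat.of Rᵐᵒᵖ M) ((homF R (TPow R M i)).obj Y)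

variable {R M}

theorem HomAcyclic.of_retract {X Y : ModuleCat.{u} Rᵐᵒᵖ} (r : Retract X Y)
    (h : HomAcyclic R M Y) : HomAcyclic R M X :=
  fun i n => (h i n).of_retract_right (r.map (homF R (TPow R M i)))

/-- Condition (T) dualized: for `E = F^∨` with `F` free, `Hom(M^{⊗i}, E)` is `(M^{⊗i} ⊗ F)^∨`, and
balance applies. -/
theorem ConditionT.homAcyclic (hT : ConditionT R M) (E : ModuleCat.{u} Rᵐᵒᵖ) [Injective E] :
    HomAcyclic R M E := by
  obtain ⟨J, ⟨r⟩⟩ := exists_retract_rDual E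
  refine HomAcyclic.of_retract r fun i n => ?_
  exact ((extVanishes_lDual_iff n (tensorObj R (TPow R M i) _) (ModuleCat.of Rᵐᵒᵖ M)).1
    (hT.torAcyclic (ModuleCat.of R (J →₀ R)) i n)).of_iso_right (homRDualIso _ _)

theorem homF_zero_shortExact {S : ShortComplex (ModuleCat.{u} Rᵐᵒᵖ)} (hS : S.ShortExact) :
    (S.map (homF R (TPow R M 0))).ShortExact :=
  ShortComplex.shortExact_of_iso (S.mapNatIso (homFZeroIso M)).symm hS

theorem homF_succ_shortExact {S : ShortComplex (ModuleCat.{u} Rᵐᵒᵖ)} {i : ℕ}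
    (hS : (S.map (homF R (TPow R M i))).ShortExact)
    (h : ExtVanishes 1 (ModuleCat.of Rᵐᵒᵖ M) ((homF R (TPow R M i)).obj S.X₁)) :
    (S.map (homF R (TPow R M (i + 1)))).ShortExact :=
  ShortComplex.shortExact_of_iso (S.mapNatIso (homFSuccIso M i)).symm (homF_shortExact M hS h)

theorem HomAcyclic.shortExact {S : ShortComplex (ModuleCat.{u} Rᵐᵒᵖ)} (hS : S.ShortExact)
    (h : HomAcyclic R M S.X₁) (i : ℕ) : (S.map (homF R (TPow R M i))).ShortExact := by
  induction i with
  | zero => exact homF_zero_shortExact hS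
  | succ i ih => exact homF_succ_shortExact ih (h i 0)

theorem HomAcyclic.X₃ {S : ShortComplex (ModuleCat.{u} Rᵐᵒᵖ)} (hS : S.ShortExact)
    (h₁ : HomAcyclic R M S.X₁) (h₂ : HomAcyclic R M S.X₂) : HomAcyclic R M S.X₃ := fun i n =>
  ExtVanishes.right_X₃ (h₁.shortExact hS i) (h₂ i n) (h₁ i (n + 1))

variable (M) in
theorem homF_comm (i : ℕ) (Y : ModuleCat.{u} Rᵐᵒᵖ) :
    Nonempty ((homF R (TPow R M i)).obj ((homF R M).obj Y) ≅
      (homF R (TPow R M (i + 1))).obj Y) := by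
  induction i with
  | zero => exact ⟨(homFZeroIso M).app ((homF R M).obj Y) ≪≫
      ((homF R M).mapIso ((homFZeroIso M).app Y)).symm ≪≫ ((homFSuccIso M 0).app Y).symm⟩
  | succ i ih =>
    obtain ⟨e⟩ := ih
    exact ⟨(homFSuccIso M i).app ((homF R M).obj Y) ≪≫ (homF R M).mapIso e ≪≫
      ((homFSuccIso M (i + 1)).app Y).symm⟩

theorem HomAcyclic.hom {Y : ModuleCat.{u} Rᵐᵒᵖ} (h : HomAcyclic R M Y) :
    HomAcyclic R M ((homF R M).obj Y) := fun i n => by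
  obtain ⟨e⟩ := homF_comm M i Y
  exact (h (i + 1) n).of_iso_right e

theorem HomAcyclic.homPow {Y : ModuleCat.{u} Rᵐᵒᵖ} (h : HomAcyclic R M Y) (i : ℕ) :
    HomAcyclic R M ((homF R (TPow R M i)).obj Y) := by
  induction i with
  | zero => exact h.of_retract ((homFZeroIso M).app Y).retract
  | succ i ih => exact ih.hom.of_retract ((homFSuccIso M i).app Y).retract

/-- `Hom(M, -)` keeps the short exact pieces of an injective coresolution of a Hom-acyclic module
exact, and sends injectives to modules of injective dimension at most `d`. -/
theorem HomAcyclic.hom_finite (hT : ConditionT R M) {d : ℕ}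
    (hd : HasResolutionOfLength IsFlatLeft d (ModuleCat.of R M)) {Y : ModuleCat.{u} Rᵐᵒᵖ}
    (h : HomAcyclic R M Y) {n : ℕ} (hn : HasInjectiveDimensionLE Y n) :
    ∃ m, HasInjectiveDimensionLE ((homF R M).obj Y) m := by
  refine injectiveDimension_induction (C := HomAcyclic R M)
    (p := fun Y => ∃ m, HasInjectiveDimensionLE ((homF R M).obj Y) m)
    (fun S hS hI h₁ => HomAcyclic.X₃ hS h₁ (hT.homAcyclic _))
    (fun E hE => ⟨d, hasInjectiveDimensionLE_homObj_injective hd E⟩) ?_ h n hn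
  rintro S hS hI h₁ ⟨m₁, h₃⟩ ⟨m₂, h₂⟩
  have h0 : ExtVanishes 1 (ModuleCat.of Rᵐᵒᵖ M) S.X₁ :=
    (h₁ 0 0).of_iso_right ((homFZeroIso M).app S.X₁).symm
  have h₃' : HasInjectiveDimensionLT (S.map (homF R M)).X₃ (m₁ + 1) := h₃
  have h₂' : HasInjectiveDimensionLT (S.map (homF R M)).X₂ (m₂ + 1) := h₂
  exact ⟨max (m₁ + 1) m₂, (homF_shortExact M hS h0).hasInjectiveDimensionLT_X₁ _
    (hasInjectiveDimensionLT_of_ge _ (m₁ + 1) _ (by omega))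
    (hasInjectiveDimensionLT_of_ge _ (m₂ + 1) _ (by omega))⟩

theorem homPow_injective_finite (hT : ConditionT R M) {d : ℕ}
    (hd : HasResolutionOfLength IsFlatLeft d (ModuleCat.of R M)) (E : ModuleCat.{u} Rᵐᵒᵖ)
    [Injective E] (i : ℕ) : ∃ m, HasInjectiveDimensionLE ((homF R (TPow R M i)).obj E) m := by
  induction i with
  | zero =>
    have : HasInjectiveDimensionLT ((𝟭 (ModuleCat.{u} Rᵐᵒᵖ)).obj E) 1 :=
      injective_iff_hasInjectiveDimensionLT_one.1 ‹Injective E›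
    exact ⟨0, hasInjectiveDimensionLT_of_iso ((homFZeroIso M).app E).symm 1⟩
  | succ i ih =>
    obtain ⟨m, hm⟩ := ih
    obtain ⟨k, hk⟩ := HomAcyclic.hom_finite hT hd ((hT.homAcyclic E).homPow i) hm
    have hk' : HasInjectiveDimensionLT
      ((homF R (TPow R M i) ⋙ homF R M).obj E) (k + 1) := hk
    exact ⟨k, hasInjectiveDimensionLT_of_iso ((homFSuccIso M i).app E).symm (k + 1)⟩

theorem HomAcyclic.extVanishes_tpow {Y : ModuleCat.{u} Rᵐᵒᵖ} (h : HomAcyclic R M Y) (i : ℕ) :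
    ExtVanishes 1 (ModuleCat.of Rᵐᵒᵖ (TPow R M i)) Y := by
  obtain ⟨S, hS, hI, rfl⟩ := exists_injective_shortExact Y
  refine ExtVanishes.one_of_lift hS .of_injective fun φ => ?_
  obtain ⟨ψ, hψ⟩ := (h.shortExact hS i).moduleCat_surjective_g
    ((homObjEquiv (TPow R M i) S.X₃).symm φ.hom)
  exact ⟨ModuleCat.ofHom (homObjEquiv (TPow R M i) S.X₂ ψ), ModuleCat.hom_ext hψ⟩

variable (R M) in
/-- The right `R`-module underlying the right `T_R(M)`-module `T_R(M)`. -/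
def restrictOpIso : (ModuleCat.restrictScalars (TensorRing.incl R M).op).obj
    (ModuleCat.of (TensorRing R M)ᵐᵒᵖ (TensorRing R M)ᵐᵒᵖ) ≅
      ModuleCat.of Rᵐᵒᵖ (TensorRing R M) :=
  LinearEquiv.toModuleIso
    { (opAddEquiv : TensorRing R M ≃+ (TensorRing R M)ᵐᵒᵖ).symm with
      map_smul' := fun _ _ => rfl }

theorem HomAcyclic.coind_shortExact {S : ShortComplex (ModuleCat.{u} Rᵐᵒᵖ)} (hS : S.ShortExact)
    (h : HomAcyclic R M S.X₁) :
    (S.map (ModuleCat.coextendScalars (TensorRing.incl R M).op)).ShortExact :=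
  coextendScalars_shortExact _ hS <|
    ((TensorRing.isCoprod_right R M).extVanishes h.extVanishes_tpow).of_iso_left
      (restrictOpIso R M)

theorem HomAcyclic.homFromExact_coind (hT : ConditionT R M)
    {I : CochainComplex (ModuleCat.{u} (TensorRing R M)ᵐᵒᵖ) ℤ} (hI : IsCompleteInjRes I)
    {Y : ModuleCat.{u} Rᵐᵒᵖ} (h : HomAcyclic R M Y) {n : ℕ} (hn : HasInjectiveDimensionLE Y n) :
    HomFromExact (Coind R M Y) I := by
  refine injectiveDimension_induction (C := HomAcyclic R M)
    (p := fun Y => HomFromExact (Coind R M Y) I)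
    (fun S hS hE h₁ => HomAcyclic.X₃ hS h₁ (hT.homAcyclic _))
    (fun E hE => hI.hom_exact _ inferInstance)
    (fun S hS hE h₁ h₃ h₂ => ?_) h n hn
  exact HomFromExact.of_shortExact hI.injective (h₁.coind_shortExact hS) h₃ h₂

/-- An injective right `T`-module is a retract of the character module of a free left one.
Restriction commutes with characters, so balance reduces this to the restricted free module. -/
theorem ConditionT.extVanishes_restrict_injective (hT : ConditionT R M)
    (E : ModuleCat.{u} (TensorRing R M)ᵐᵒᵖ) [Injective E] (n : ℕ) :
    ExtVanishes (n + 1) (ModuleCat.of Rᵐᵒᵖ M)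
      ((ModuleCat.restrictScalars (TensorRing.incl R M).op).obj E) := by
  obtain ⟨J, ⟨r⟩⟩ := exists_retract_rDual E
  have h := (extVanishes_lDual_iff n _ (ModuleCat.of Rᵐᵒᵖ M)).1 (hT.extVanishes_restrict
    (ModuleCat.of (TensorRing R M) (J →₀ TensorRing R M)) n)
  exact (h.of_iso_right (restrictRDualIso _ _)).of_retract_right
    (r.map (ModuleCat.restrictScalars (TensorRing.incl R M).op))

theorem isCocompatible_of_finite (hT : ConditionT R M) {d k : ℕ}
    (hd : HasResolutionOfLength IsFlatLeft d (ModuleCat.of R M))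
    (hk : HasProjectiveDimensionLE (ModuleCat.of Rᵐᵒᵖ M) k) : IsCocompatible R M M := by
  intro I hI
  constructor
  · have hacyc : (restrictComplexOp R M I).Acyclic := acyclic_restrictScalars _ hI.exact
    refine homFromExact_of_extVanishes hacyc fun j => ?_
    refine extVanishes_kerD_right (kerDSeq_shortExact hacyc) (fun _ => Iso.refl _)
      (fun _ => Iso.refl _) (fun j n => ?_) (d := k + 1) j 0
    have := hI.injective j
    exact hT.extVanishes_restrict_injective (I.X j) n
  · intro E hE
    obtain ⟨m, hm⟩ := (hT.homAcyclic E).hom_finite hT hd (n := 0)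
      (injective_iff_hasInjectiveDimensionLT_one.1 hE)
    exact (hT.homAcyclic E).hom.homFromExact_coind hT hI hm

/-- The cycles of an acyclic complex of injectives are `Hom`-acyclic if `M` has finite projective
dimension on the right. -/
theorem homAcyclic_kerD (hT : ConditionT R M) {k : ℕ}
    (hk : HasProjectiveDimensionLE (ModuleCat.of Rᵐᵒᵖ M) k)
    {Q : CochainComplex (ModuleCat.{u} Rᵐᵒᵖ) ℤ} (hQ : Q.Acyclic) (hI : ∀ j, Injective (Q.X j))
    (j : ℤ) : HomAcyclic R M (kerD Q j) := by
  have ext_of : ∀ i, (∀ j, ((kerDSeq Q j).map (homF R (TPow R M i))).ShortExact) → ∀ j n,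
      ExtVanishes (n + 1) (ModuleCat.of Rᵐᵒᵖ M) ((homF R (TPow R M i)).obj (kerD Q j)) :=
    fun i h j n => extVanishes_kerD_right h
      (Z := fun j => (homF R (TPow R M i)).obj (kerD Q j)) (fun _ => Iso.refl _)
      (fun _ => Iso.refl _) (fun j n => have := hI j; hT.homAcyclic (Q.X j) i n) (d := k + 1) j n
  have key : ∀ i j, ((kerDSeq Q j).map (homF R (TPow R M i))).ShortExact := fun i => by
    induction i with
    | zero => exact fun j => homF_zero_shortExact (kerDSeq_shortExact hQ j)
    -- The obstruction to exactness of `Hom` sits at the left end, so the cycles in degree `j`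
    -- enter, whereas tensoring needed those in degree `j + 1`.
    | succ i ih => exact fun j => homF_succ_shortExact (ih j) (ext_of i ih j 0)
  exact fun i n => ext_of i (key i) j n

theorem isCoadmissible_of_finite (hT : ConditionT R M) {d k : ℕ}
    (hd : HasResolutionOfLength IsFlatLeft d (ModuleCat.of R M))
    (hk : HasProjectiveDimensionLE (ModuleCat.of Rᵐᵒᵖ M) k) : IsCoadmissible R M := by
  rintro H ⟨I, hI, ⟨e⟩⟩ E hE i
  have e' : H ≅ kerD I 0 := e
  constructor
  · obtain ⟨m, hm⟩ := homPow_injective_finite hT hd E i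
    exact ((hI.homFromExact hm).extVanishes hI.exact hI.injective 0).of_iso_right e'
  · exact ((homAcyclic_kerD hT hk hI.exact hI.injective 0).of_retract e'.retract) i 0

end Right

end

end GorTensor

theorem mainTheorem5 (R M : Type u) [Ring R] [AddCommGroup M] [Module R M] [Module Rᵐᵒᵖ M]
    [SMulCommClass R Rᵐᵒᵖ M] (N : ℕ) (hN : GorTensor.IsNilpotentBimod R M N)
    (hT : GorTensor.ConditionT R M) :
    (projectiveDimension (ModuleCat.of R M) < ⊤ →
      GorTensor.FiniteFlatDimRight (ModuleCat.of Rᵐᵒᵖ M) →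
        GorTensor.IsCompatible R M M ∧ GorTensor.IsAdmissible R M) ∧
    (GorTensor.FiniteFlatDimLeft (ModuleCat.of R M) →
      projectiveDimension (ModuleCat.of Rᵐᵒᵖ M) < ⊤ →
        GorTensor.IsCocompatible R M M ∧ GorTensor.IsCoadmissible R M) := by
  constructor
  · rintro hp ⟨k, hk⟩
    obtain ⟨d, hd⟩ := (projectiveDimension_ne_top_iff _).1 hp.ne
    have hk' := GorTensor.hasInjectiveDimensionLE_lDual_of_resolution k _ hk
    exact ⟨GorTensor.isCompatible_of_finite hT hd hk', GorTensor.isAdmissible_of_finite hT hd hk'⟩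
  · rintro ⟨d, hd⟩ hp
    obtain ⟨k, hk⟩ := (projectiveDimension_ne_top_iff _).1 hp.ne
    exact ⟨GorTensor.isCocompatible_of_finite hT hd hk, GorTensor.isCoadmissible_of_finite hT hd hk⟩
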